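/- Let $\Omega\subset\mathbb{R}^3$ be compact (for instance a compact domain with smooth or piecewise smooth boundary), let $\alpha$ be a smooth 2-form on $\Omega$ (for instance a closed 2-form whose restriction to $\partial\Omega$ vanishes), and let $V$ be the vector field on $\Omega$ dual to $\alpha$, i.e. $\alpha(W_1,W_2)=d\mathrm{Vol}(V,W_1,W_2)$, where $d\mathrm{Vol}$ is the standard volume form of $\mathbb{R}^3$. Let $C_2(\Omega)=\{(x,y)\in\Omega\times\Omega : x\neq y\}$, and let $C_2[\Omega]$ be its Fulton–MacPherson compactification, that is, the closure in $\Omega\times\Omega\times S^2\times S^2$ of the image of $C_2(\Omega)$ under $$\iota_2(x,y)=\Bigl(x,\;y,\;\tfrac{x-y}{|x-y|},\;\tfrac{y-x}{|y-x|}\Bigr).$$ $C_2[\Omega]$ is a subset of the 6-dimensional manifold with boundary $C_2[\mathbb{R}^3]$, oriented so that $d\mathrm{Vol}_x\wedge d\mathrm{Vol}_y$ is positive on $C_2(\mathbb{R}^3)$. Let $\alpha_x,\alpha_y$ be the pullbacks of $\alpha$ to $C_2[\Omega]$ under $(x,y)\mapsto x$ and $(x,y)\mapsto y$; let $g\colon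 C_2[\Omega]\to S^2$ be the Gauss map, the continuous extension of $(x,y)\mapsto (y-x)/|y-x|$ (the last coordinate); let $d\mathrm{Vol}_{S^2}$ be the area form of $S^2$ (outward normal orientation) normalized to total area $1$; and let $\Phi=\alpha_x\wedge\alpha_y\wedge g^*d\mathrm{Vol}_{S^2}$. Then: 1. on $C_2(\Omega)$ the 6-form $\Phi$ is equal to $$\frac1{4\pi}\,V(x)\times V(y)\cdot\frac{x-y}{|x-y|^3}\;d\mathrm{Vol}_x\wedge d\mathrm{Vol}_y ;$$ 2. the function $V(x)\times V(y)\cdot\frac{x-y}{|x-y|^3}$ is absolutely integrable on $\Omega\times\Omega$; 3. the integral of $\Phi$ over $C_2[\Omega]$ converges absolutely, and the configuration-space helicity equals the classical helicity: $$\int_{C_2[\Omega]}\alpha_x\wedge\alpha_y\wedge g^*d\mathrm{Vol}_{S^2}=\frac1{4\pi}\int_{\Omega\times\Omega}V(x)\times V(y)\cdot\frac{x-y}{|x-y|^3}\;d\mathrm{Vol}_x\,d\mathrm{Vol}_y .$$ -/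

import Mathlib

open scoped ContDiff

noncomputable section

namespace Helicity

/-- Euclidean three-space. -/
abbrev E3 : Type := EuclideanSpace ℝ (Fin 3)

/-! ### Exterior algebra -/

/-- The wedge product of a `p`-form and a `q`-form on a real vector space: the signed sum over
`(p, q)`-shuffles, so that `(dx ∧ dy) (∂x, ∂y) = 1`. -/
def wedge {M : Type*} [AddCommGroup M] [Module ℝ M] {p q : ℕ}
    (a : M [⋀^Fin p]→ₗ[ℝ] ℝ) (b : M [⋀^Fin q]→ₗ[ℝ] ℝ) : M [⋀^Fin (p + q)]→ₗ[ℝ] ℝ :=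
  ((LinearMap.mul' ℝ ℝ).compAlternatingMap (a.domCoprod b)).domDomCongr finSumFinEquiv

/-- The standard volume form `dx₁ ∧ dx₂ ∧ dx₃` of `ℝ³`. -/
def dVol : E3 [⋀^Fin 3]→ₗ[ℝ] ℝ :=
  (EuclideanSpace.basisFun (Fin 3) ℝ).toBasis.det

/-- The unit area form of the sphere `S²`, of total area `1`: at `u ∈ S²` it sends the tangent
vectors `a, b` to `(1 / 4π) dVol (u, a, b)` (orientation by the outward normal). -/
def unitArea (u : E3) : E3 [⋀^Fin 2]→ₗ[ℝ] ℝ :=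
  (1 / (4 * Real.pi)) • dVol.curryLeft u

/-! ### The compactified configuration space of two points -/

/-- The Euclidean space `ℝ³ × ℝ³ × ℝ³ × ℝ³`, in which `A₂[ℝ³] = ℝ³ × ℝ³ × S² × S²` sits. -/
abbrev Amb : Type := E3 × E3 × E3 × E3

/-- The product `A₂[Ω] = Ω × Ω × S² × S²`. -/
def A2 (Ω : Set E3) : Set Amb :=
  Ω ×ˢ Ω ×ˢ Metric.sphere 0 1 ×ˢ Metric.sphere 0 1

/-- The open configuration space `C₂(Ω)` of ordered pairs of distinct points of `Ω`. -/
def C2Open (Ω : Set E3) : Set (E3 × E3) :=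
  {p | p.1 ∈ Ω ∧ p.2 ∈ Ω ∧ p.1 ≠ p.2}

/-- The unit vector in the direction of `v` (for `v ≠ 0`). -/
def dir (v : E3) : E3 := ‖v‖⁻¹ • v

/-- The map `ι₂ = ι × π₁₂ × π₂₁ : C₂(ℝ³) → A₂[ℝ³]`, where `π₁₂` and `π₂₁` are the directions of
`x - y` and of `y - x`. -/
def iota (p : E3 × E3) : Amb :=
  (p.1, p.2, dir (p.1 - p.2), dir (p.2 - p.1))

/-- The Fulton–MacPherson compactification `C₂[Ω]`: the closure in `A₂[Ω]` of the image of
`C₂(Ω)` under `ι₂`. -/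
def C2 (Ω : Set E3) : Set Amb :=
  A2 Ω ∩ closure (iota '' C2Open Ω)

/-- The projection `(x, y) ↦ x` on `C₂[ℝ³]`. -/
def projX : Amb →ₗ[ℝ] E3 := LinearMap.fst ℝ E3 (E3 × E3 × E3)

/-- The projection `(x, y) ↦ y` on `C₂[ℝ³]`. -/
def projY : Amb →ₗ[ℝ] E3 := LinearMap.fst ℝ E3 (E3 × E3) ∘ₗ LinearMap.snd ℝ E3 (E3 × E3 × E3)

/-- The Gauss map, extended from `C₂(ℝ³)` to `C₂[ℝ³]`: it is the coordinate `π₂₁`. -/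
def gauss : Amb →ₗ[ℝ] E3 :=
  LinearMap.snd ℝ E3 E3 ∘ₗ LinearMap.snd ℝ E3 (E3 × E3) ∘ₗ LinearMap.snd ℝ E3 (E3 × E3 × E3)

theorem projX_iota (p : E3 × E3) : projX (iota p) = p.1 := rfl

theorem projY_iota (p : E3 × E3) : projY (iota p) = p.2 := rfl

theorem gauss_iota (p : E3 × E3) : gauss (iota p) = ‖p.2 - p.1‖⁻¹ • (p.2 - p.1) := rfl

/-! ### Forms on `C₂[Ω]`

A differential form on a subset of `C₂[ℝ³]` is given by alternating forms on the ambient space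
at the points of the subset, of which only the pullbacks to `C₂[ℝ³]` are used.  The maps `projX`,
`projY`, `gauss` are linear on the ambient space, hence equal to their own derivatives. -/

/-- `α_x`, the pullback of the 2-form `α` by `(x, y) ↦ x`. -/
def formX (α : E3 → E3 [⋀^Fin 2]→L[ℝ] ℝ) (q : Amb) : Amb [⋀^Fin 2]→ₗ[ℝ] ℝ :=
  (α (projX q)).toAlternatingMap.compLinearMap projX

/-- `α_y`, the pullback of the 2-form `α` by `(x, y) ↦ y`. -/
def formY (α : E3 → E3 [⋀^Fin 2]→L[ℝ] ℝ) (q : Amb) : Amb [⋀^Fin 2]→ₗ[ℝ] ℝ :=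
  (α (projY q)).toAlternatingMap.compLinearMap projY

/-- `g^* dVol_{S²}`, the pullback of the unit area form by the Gauss map. -/
def gaussForm (q : Amb) : Amb [⋀^Fin 2]→ₗ[ℝ] ℝ :=
  (unitArea (gauss q)).compLinearMap gauss

/-- The 6-form `Φ = α_x ∧ α_y ∧ g^* dVol_{S²}`. -/
def Phi (α : E3 → E3 [⋀^Fin 2]→L[ℝ] ℝ) (q : Amb) : Amb [⋀^Fin 6]→ₗ[ℝ] ℝ :=
  wedge (wedge (formX α q) (formY α q)) (gaussForm q)

/-- The 6-form `dVol_x ∧ dVol_y`, which orients `C₂[ℝ³]`. -/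
def volXY : Amb [⋀^Fin 6]→ₗ[ℝ] ℝ :=
  wedge (dVol.compLinearMap projX) (dVol.compLinearMap projY)

/-! ### Integration of 6-forms over subsets of `C₂[ℝ³]`

`C₂[ℝ³]` is a 6-dimensional submanifold with boundary of the ambient space; its boundary is the
face `x = y`.  It carries the orientation for which `dVol_x ∧ dVol_y` is positive at the points
with `x ≠ y`.  Coordinates are taken in `ℝ⁶ = ℝ³ × ℝ³`. -/

/-- The standard frame of `ℝ⁶ = ℝ³ × ℝ³`. -/
def frame : Fin 6 → E3 × E3 :=
  ![(EuclideanSpace.single 0 1, 0), (EuclideanSpace.single 1 1, 0), (EuclideanSpace.single 2 1, 0),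
    (0, EuclideanSpace.single 0 1), (0, EuclideanSpace.single 1 1), (0, EuclideanSpace.single 2 1)]

/-- The closed half-space of `ℝ⁶` where the first coordinate is nonnegative. -/
def halfSpace : Set (E3 × E3) := {t | 0 ≤ t.1 0}

/-- The coefficient at `t` of the pullback `φ^* η` with respect to the standard volume form of
`ℝ⁶`, for a map `φ` defined on `D`. -/
def coeff (η : Amb → Amb [⋀^Fin 6]→ₗ[ℝ] ℝ) (D : Set (E3 × E3)) (φ : E3 × E3 → Amb)
    (t : E3 × E3) : ℝ :=
  η (φ t) (fun i => fderivWithin ℝ φ D t (frame i))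

/-- `φ : D → C₂[ℝ³]` is a positively oriented smooth local parametrization, where `D` is a
relatively open subset of the closed half-space. -/
structure IsOrientedParam (D : Set (E3 × E3)) (φ : E3 × E3 → Amb) : Prop where
  relOpen : ∃ U : Set (E3 × E3), IsOpen U ∧ D = U ∩ halfSpace
  smooth : ContDiffOn ℝ ∞ φ D
  injOn : Set.InjOn φ D
  mapsTo : Set.MapsTo φ D (C2 Set.univ)
  immersion : ∀ t ∈ D, Function.Injective (fderivWithin ℝ φ D t)
  oriented : ∀ t ∈ D, projX (φ t) ≠ projY (φ t) → 0 < coeff (fun _ => volXY) D φ t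

/-- A cutting of `X ⊆ C₂[ℝ³]` into countably many disjoint pieces `φ i '' T i`, each one
parametrized, with positive orientation, by a Lebesgue measurable set of `ℝ⁶`. -/
structure IsCutting (X : Set Amb) (D T : ℕ → Set (E3 × E3)) (φ : ℕ → E3 × E3 → Amb) :
    Prop where
  param : ∀ i, IsOrientedParam (D i) (φ i)
  subset : ∀ i, T i ⊆ D i
  measurable : ∀ i, MeasurableSet (T i)
  disjoint : Pairwise fun i j => Disjoint (φ i '' T i) (φ j '' T j)
  cover : (⋃ i, φ i '' T i) = X

/-- `∫_X η = I`, as an absolutely convergent integral of a 6-form over a subset `X` of the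
oriented manifold with boundary `C₂[ℝ³]`: `X` can be cut into parametrized pieces, and for every
such cutting the integrals of `η` over the pieces, computed in the parameters, converge absolutely
and add up to `I`. -/
def HasFormIntegral (η : Amb → Amb [⋀^Fin 6]→ₗ[ℝ] ℝ) (X : Set Amb) (I : ℝ) : Prop :=
  (∃ D T φ, IsCutting X D T φ) ∧
    ∀ D T φ, IsCutting X D T φ →
      (∀ i, MeasureTheory.IntegrableOn (coeff η (D i) (φ i)) (T i)) ∧
      (Summable fun i => ∫ t in T i, |coeff η (D i) (φ i) t|) ∧
      HasSum (fun i => ∫ t in T i, coeff η (D i) (φ i) t) I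

/-! ### The classical helicity -/

/-- `V(x) × V(y) · (x - y) / |x - y|³`. -/
def classicalIntegrand (V : E3 → E3) (p : E3 × E3) : ℝ :=
  (crossProduct (V p.1).ofLp (V p.2).ofLp ⬝ᵥ (p.1 - p.2).ofLp) / ‖p.1 - p.2‖ ^ 3

end Helicity

end

/-!
Both integrals are computed in the coordinates `(x, y)`, which are global on the open
configuration space.

*The integrand.*  Let `u = (y - x) / |y - x|`.  The derivative of the Gauss map sends `(a, b)` to
`(b - a) / |y - x|` up to a multiple of `u`, which the area form at `u` does not see.  Since
`α_x = dVol (V(x), ·, ·)` and `α_y = dVol (V(y), ·, ·)`, the product `α_x ∧ α_y ∧ γ` only sees the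
mixed part of a two-form `γ`: its coefficient is `γ ((V(x), 0), (0, V(y)))` (`wedge_wedge_section`).
For `γ = g^* dVol_{S²}` this is the classical integrand (`coeff_Phi_iota`).

*Integrability.*  The field `V` is bounded on the compact set `Ω`, so the integrand is
`O(|x - y|⁻²)`, and `|z|⁻²` is locally integrable in dimension three
(`integrableOn_classicalIntegrand`).

*Independence of the cutting.*  At points off the boundary face `x = y`, a parametrization `φ` of
`C₂[ℝ³]` factors as `ι₂ ∘ ψ` with `ψ = (x, y) ∘ φ`.  Hence the coefficient of a 6-form in `φ` is
its coefficient in `(x, y)` at `ψ` times `det Dψ`, and the latter is positive by orientation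
(`IsOrientedParam.coeff_eq`, `IsOrientedParam.det_pos`).  The parameters of boundary points lie on
the boundary hyperplane of the half-space, a null set: at an interior parameter the smooth
nonnegative function `|y - x|` would have a minimum, and then `Dφ` would have rank at most `5`
(`IsOrientedParam.ne_of_pos`).  The change of variables formula turns the pieces of a cutting into
disjoint measurable sets that fill `Ω × Ω` up to the diagonal (`IsCutting.hasSum`).

*Existence of a cutting.*  Polar coordinates of `x - y` around `y`, with stereographic coordinates
for the direction and the radius rescaled so that the formulas are polynomial, are oriented
parametrizations; two of them cover `C₂[ℝ³]` (`isOrientedParam_chart`, `exists_isCutting`).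
-/

namespace Helicity

open MeasureTheory Set Filter Topology

/-! ### Evaluating wedge products -/

section Wedge

variable {M : Type*} [AddCommGroup M] [Module ℝ M] {p q : ℕ}

theorem wedge_apply (a : M [⋀^Fin p]→ₗ[ℝ] ℝ) (b : M [⋀^Fin q]→ₗ[ℝ] ℝ) (m : Fin (p + q) → M) :
    wedge a b m = ∑ σ : Equiv.Perm.ModSumCongr (Fin p) (Fin q),
      LinearMap.mul' ℝ ℝ (AlternatingMap.domCoprod.summand a b σ (m ∘ finSumFinEquiv)) := by
  simp only [wedge, AlternatingMap.domDomCongr_apply, LinearMap.compAlternatingMap_apply]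
  change LinearMap.mul' ℝ ℝ ((∑ σ : Equiv.Perm.ModSumCongr (Fin p) (Fin q),
    AlternatingMap.domCoprod.summand a b σ) (m ∘ finSumFinEquiv)) = _
  rw [sum_apply, map_sum]

theorem mul'_summand (a : M [⋀^Fin p]→ₗ[ℝ] ℝ) (b : M [⋀^Fin q]→ₗ[ℝ] ℝ)
    (σ : Equiv.Perm (Fin p ⊕ Fin q)) (m : Fin p ⊕ Fin q → M) :
    LinearMap.mul' ℝ ℝ (AlternatingMap.domCoprod.summand a b (Quotient.mk'' σ) m) =
      Equiv.Perm.sign σ •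
        (a (fun i => m (σ (Sum.inl i))) * b (fun i => m (σ (Sum.inr i)))) := by
  rw [AlternatingMap.domCoprod.summand_mk'', smul_apply,
    MultilinearMap.domDomCongr_apply, MultilinearMap.domCoprod_apply]
  rcases Int.units_eq_one_or (Equiv.Perm.sign σ) with h | h <;> simp [h]

theorem wedge_add_left (a a' : M [⋀^Fin p]→ₗ[ℝ] ℝ) (b : M [⋀^Fin q]→ₗ[ℝ] ℝ) :
    wedge (a + a') b = wedge a b + wedge a' b := by
  ext m
  simp only [wedge_apply, AlternatingMap.add_apply, ← Finset.sum_add_distrib]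
  refine Finset.sum_congr rfl fun σ _ => ?_
  induction σ using Quotient.inductionOn' with | _ σ
  simp only [mul'_summand, AlternatingMap.add_apply, add_mul, smul_add]

theorem wedge_add_right (a : M [⋀^Fin p]→ₗ[ℝ] ℝ) (b b' : M [⋀^Fin q]→ₗ[ℝ] ℝ) :
    wedge a (b + b') = wedge a b + wedge a b' := by
  ext m
  simp only [wedge_apply, AlternatingMap.add_apply, ← Finset.sum_add_distrib]
  refine Finset.sum_congr rfl fun σ _ => ?_
  induction σ using Quotient.inductionOn' with | _ σ
  simp only [mul'_summand, AlternatingMap.add_apply, mul_add, smul_add]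

theorem wedge_smul_left (c : ℝ) (a : M [⋀^Fin p]→ₗ[ℝ] ℝ) (b : M [⋀^Fin q]→ₗ[ℝ] ℝ) :
    wedge (c • a) b = c • wedge a b := by
  ext m
  simp only [wedge_apply, AlternatingMap.smul_apply, Finset.smul_sum]
  refine Finset.sum_congr rfl fun σ _ => ?_
  induction σ using Quotient.inductionOn' with | _ σ
  simp only [mul'_summand, AlternatingMap.smul_apply, smul_eq_mul, mul_assoc, mul_smul_comm]

theorem wedge_smul_right (c : ℝ) (a : M [⋀^Fin p]→ₗ[ℝ] ℝ) (b : M [⋀^Fin q]→ₗ[ℝ] ℝ) :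
    wedge a (c • b) = c • wedge a b := by
  ext m
  simp only [wedge_apply, AlternatingMap.smul_apply, Finset.smul_sum]
  refine Finset.sum_congr rfl fun σ _ => ?_
  induction σ using Quotient.inductionOn' with | _ σ
  simp only [mul'_summand, AlternatingMap.smul_apply, smul_eq_mul, mul_left_comm _ c,
    mul_smul_comm]

/-- `a` is annihilated by `w`: the interior product of `a` with `w` vanishes. -/
def Annihilates (w : M) (a : M [⋀^Fin p]→ₗ[ℝ] ℝ) : Prop :=
  ∀ v : Fin p → M, (∃ i, v i = w) → a v = 0

theorem Annihilates.wedge {w : M} {a : M [⋀^Fin p]→ₗ[ℝ] ℝ} {b : M [⋀^Fin q]→ₗ[ℝ] ℝ}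
    (ha : Annihilates w a) (hb : Annihilates w b) : Annihilates w (wedge a b) := by
  rintro m ⟨k, hk⟩
  rw [wedge_apply]
  refine Finset.sum_eq_zero fun σ _ => ?_
  induction σ using Quotient.inductionOn' with | _ σ
  rw [mul'_summand]
  obtain ⟨l, hl⟩ : ∃ l, finSumFinEquiv (σ l) = k :=
    ⟨σ.symm (finSumFinEquiv.symm k), by simp⟩
  rcases l with i | j
  · rw [ha _ ⟨i, by simp [hl, hk]⟩, zero_mul, smul_zero]
  · rw [hb _ ⟨j, by simp [hl, hk]⟩, mul_zero, smul_zero]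

theorem wedge_apply_of_shuffle (a : M [⋀^Fin p]→ₗ[ℝ] ℝ) (b : M [⋀^Fin q]→ₗ[ℝ] ℝ)
    (m : Fin (p + q) → M)
    (h : ∀ σ : Equiv.Perm (Fin p ⊕ Fin q), ¬ MapsTo σ (range Sum.inl) (range Sum.inl) →
      a (fun i => m (finSumFinEquiv (σ (Sum.inl i)))) *
        b (fun j => m (finSumFinEquiv (σ (Sum.inr j)))) = 0) :
    wedge a b m = a (fun i => m (Fin.castAdd q i)) * b (fun j => m (Fin.natAdd p j)) := by
  rw [wedge_apply]
  refine (Fintype.sum_eq_single (Quotient.mk'' (1 : Equiv.Perm (Fin p ⊕ Fin q))) ?_).trans ?_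
  · intro σ hσ
    induction σ using Quotient.inductionOn' with | _ σ
    rw [mul'_summand]
    by_cases hmaps : MapsTo σ (range Sum.inl) (range Sum.inl)
    · refine absurd ?_ hσ
      rw [Quotient.eq'', QuotientGroup.leftRel_apply, mul_one, inv_mem_iff]
      exact Equiv.Perm.mem_sumCongrHom_range_of_perm_mapsTo_inl hmaps
    · exact (congrArg _ (h σ hmaps)).trans (smul_zero _)
  · rw [mul'_summand]
    simp

/-- If the last `q` vectors annihilate the first factor, then only the identity shuffle
contributes to the wedge product. -/
theorem wedge_apply_of_annihilates (a : M [⋀^Fin p]→ₗ[ℝ] ℝ) (b : M [⋀^Fin q]→ₗ[ℝ] ℝ)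
    (m : Fin (p + q) → M) (h : ∀ j, Annihilates (m (Fin.natAdd p j)) a) :
    wedge a b m = a (fun i => m (Fin.castAdd q i)) * b (fun j => m (Fin.natAdd p j)) := by
  refine wedge_apply_of_shuffle a b m fun σ hσ => ?_
  simp only [MapsTo, forall_mem_range, not_forall] at hσ
  obtain ⟨i, hi⟩ := hσ
  rcases hs : σ (Sum.inl i) with k | j
  · exact absurd ⟨k, hs.symm⟩ hi
  · rw [h j _ ⟨i, by simp [hs]⟩, zero_mul]

/-- If the first `p` vectors annihilate the second factor, then only the identity shuffle
contributes to the wedge product. -/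
theorem wedge_apply_of_annihilates_right (a : M [⋀^Fin p]→ₗ[ℝ] ℝ) (b : M [⋀^Fin q]→ₗ[ℝ] ℝ)
    (m : Fin (p + q) → M) (h : ∀ i, Annihilates (m (Fin.castAdd q i)) b) :
    wedge a b m = a (fun i => m (Fin.castAdd q i)) * b (fun j => m (Fin.natAdd p j)) := by
  refine wedge_apply_of_shuffle a b m fun σ hσ => ?_
  rw [Equiv.Perm.perm_mapsTo_inl_iff_mapsTo_inr] at hσ
  simp only [MapsTo, forall_mem_range, not_forall] at hσ
  obtain ⟨j, hj⟩ := hσ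
  rcases hs : σ (Sum.inr j) with i | k
  · rw [h i _ ⟨j, by simp [hs]⟩, mul_zero]
  · exact absurd ⟨k, hs.symm⟩ hj

end Wedge

/-! ### Top-degree forms in the coordinates `(x, y)` -/

/-- The standard frame of `ℝ³ × ℝ³`, as a basis. -/
noncomputable def frameBasis : Module.Basis (Fin 6) ℝ (E3 × E3) :=
  ((EuclideanSpace.basisFun (Fin 3) ℝ).toBasis.prod
    (EuclideanSpace.basisFun (Fin 3) ℝ).toBasis).reindex finSumFinEquiv

theorem coe_frameBasis : ⇑frameBasis = frame := by
  funext i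
  rw [frameBasis, Module.Basis.reindex_apply]
  obtain ⟨s, rfl⟩ := (finSumFinEquiv (m := 3) (n := 3)).surjective i
  rw [Equiv.symm_apply_apply]
  rcases s with i | i <;> fin_cases i <;> simp [frame] <;> rfl

/-- A top-degree form on `ℝ³ × ℝ³` scales by the determinant under a linear map. -/
theorem topForm_comp (f : (E3 × E3) [⋀^Fin 6]→ₗ[ℝ] ℝ) (B : (E3 × E3) →ₗ[ℝ] E3 × E3) :
    f (fun i => B (frame i)) = f frame * LinearMap.det B := by
  have h := f.eq_smul_basis_det frameBasis
  rw [coe_frameBasis] at h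
  have h2 : f (fun i => B (frame i)) = (f frame • frameBasis.det) (fun i => B (frame i)) := by
    rw [← h]
  rw [h2, ← coe_frameBasis, AlternatingMap.smul_apply, smul_eq_mul]
  congr 1
  have := frameBasis.det_comp B frameBasis
  rw [frameBasis.det_self, mul_one] at this
  exact this

theorem dVol_basis : dVol (fun i => EuclideanSpace.single i 1) = 1 := by
  have := (EuclideanSpace.basisFun (Fin 3) ℝ).toBasis.det_self
  rw [dVol]
  convert this using 2
  funext i
  simp

theorem dVol_apply (a b c : E3) :
    dVol ![a, b, c] = crossProduct a.ofLp b.ofLp ⬝ᵥ c.ofLp := by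
  rw [dVol, Module.Basis.det_apply, Matrix.det_fin_three]
  simp [Module.Basis.toMatrix_apply, cross_apply, dotProduct, Fin.sum_univ_three]
  ring

theorem annihilates_comp_of_map_eq_zero {M N : Type*} [AddCommGroup M] [Module ℝ M]
    [AddCommGroup N] [Module ℝ N] {p : ℕ} (a : N [⋀^Fin p]→ₗ[ℝ] ℝ) (L : M →ₗ[ℝ] N) {w : M}
    (hw : L w = 0) : Annihilates w (a.compLinearMap L) := by
  rintro v ⟨i, rfl⟩
  rw [AlternatingMap.compLinearMap_apply]
  exact a.map_coord_zero i hw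

theorem annihilates_curryLeft {N : Type*} [AddCommGroup N] [Module ℝ N] {p : ℕ}
    (a : N [⋀^Fin (p + 1)]→ₗ[ℝ] ℝ) (w : N) : Annihilates w (a.curryLeft w) := by
  rintro v ⟨i, hi⟩
  rw [AlternatingMap.curryLeft_apply_apply]
  refine a.map_eq_zero_of_eq _ (i := 0) (j := i.succ) ?_ (Fin.succ_ne_zero i).symm
  simp [hi]

/-- Along a linear map into the ambient space that is a section of `(x, y)`, the form
`dVol_x ∧ dVol_y` takes the value `1` on the standard frame. -/
theorem volXY_section (A : E3 × E3 →ₗ[ℝ] Amb) (hX : ∀ t, projX (A t) = t.1)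
    (hY : ∀ t, projY (A t) = t.2) : volXY (fun i => A (frame i)) = 1 := by
  rw [volXY, wedge_apply_of_annihilates (p := 3) (q := 3)]
  · simp only [AlternatingMap.compLinearMap_apply, hX, hY]
    have h1 : (fun i : Fin 3 => (frame (Fin.castAdd 3 i)).1) =
        fun i => EuclideanSpace.single i 1 := by
      funext i; fin_cases i <;> rfl
    have h2 : (fun i : Fin 3 => (frame (Fin.natAdd 3 i)).2) =
        fun i => EuclideanSpace.single i 1 := by
      funext i; fin_cases i <;> rfl
    change dVol (fun i : Fin 3 => (frame (Fin.castAdd 3 i)).1) *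
      dVol (fun i : Fin 3 => (frame (Fin.natAdd 3 i)).2) = 1
    rw [h1, h2, dVol_basis, mul_one]
  · intro j
    refine annihilates_comp_of_map_eq_zero _ _ ?_
    rw [hX]
    fin_cases j <;> rfl

/-- The even permutation that lists the standard frame `e₀, e₁, e₂, f₀, f₁, f₂` as
`e_{i+1}, e_{i+2}, f_{j+1}, f_{j+2}, e_i, f_j`, indices modulo `3`. -/
def splitPerm (i j : Fin 3) : Equiv.Perm (Fin 6) :=
  finSumFinEquiv.permCongr (Equiv.sumCongr (Equiv.addRight i) (Equiv.addRight j)) *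
    (Equiv.swap 0 1 * Equiv.swap 1 2 * Equiv.swap 2 4 * Equiv.swap 3 5)

theorem sign_splitPerm (i j : Fin 3) : Equiv.Perm.sign (splitPerm i j) = 1 := by
  have h : ∀ k : Fin 3, Equiv.Perm.sign (Equiv.addRight k) = 1 := by decide
  rw [splitPerm, Equiv.Perm.sign_mul, Equiv.Perm.sign_permCongr, Equiv.Perm.sign_sumCongr, h, h]
  decide

theorem coe_splitPerm (i j : Fin 3) : ⇑(splitPerm i j) =
    ![Fin.castAdd 3 (i + 1), Fin.castAdd 3 (i + 2), Fin.natAdd 3 (j + 1), Fin.natAdd 3 (j + 2),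
      Fin.castAdd 3 i, Fin.natAdd 3 j] := by
  revert i j; decide

theorem frame_castAdd (i : Fin 3) : frame (Fin.castAdd 3 i) = (EuclideanSpace.single i 1, 0) := by
  fin_cases i <;> rfl

theorem frame_addNat (i : Fin 3) : frame (Fin.addNat i 3) = (0, EuclideanSpace.single i 1) := by
  fin_cases i <;> rfl

theorem wedge_wedge_section_single (A : E3 × E3 →ₗ[ℝ] Amb) (hX : ∀ t, projX (A t) = t.1)
    (hY : ∀ t, projY (A t) = t.2) (i j : Fin 3) (γ : Amb [⋀^Fin 2]→ₗ[ℝ] ℝ) :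
    wedge (wedge ((dVol.curryLeft (EuclideanSpace.single i 1)).compLinearMap projX)
      ((dVol.curryLeft (EuclideanSpace.single j 1)).compLinearMap projY)) γ
        (fun k => A (frame k)) =
      γ ![A (EuclideanSpace.single i 1, 0), A (0, EuclideanSpace.single j 1)] := by
  set a : Amb [⋀^Fin 2]→ₗ[ℝ] ℝ :=
    (dVol.curryLeft (EuclideanSpace.single i 1)).compLinearMap projX with ha
  set b : Amb [⋀^Fin 2]→ₗ[ℝ] ℝ :=
    (dVol.curryLeft (EuclideanSpace.single j 1)).compLinearMap projY with hb
  have hax : Annihilates (A (EuclideanSpace.single i 1, 0)) a := by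
    rintro u ⟨k, hk⟩
    rw [ha, AlternatingMap.compLinearMap_apply]
    exact annihilates_curryLeft _ _ _ ⟨k, by rw [hk, hX]⟩
  have hay : ∀ w, Annihilates (A (0, w)) a := fun w =>
    annihilates_comp_of_map_eq_zero _ _ (by rw [hX])
  have hbx : ∀ v, Annihilates (A (v, 0)) b := fun v =>
    annihilates_comp_of_map_eq_zero _ _ (by rw [hY])
  have hby : Annihilates (A (0, EuclideanSpace.single j 1)) b := by
    rintro u ⟨k, hk⟩
    rw [hb, AlternatingMap.compLinearMap_apply]
    exact annihilates_curryLeft _ _ _ ⟨k, by rw [hk, hY]⟩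
  have hvol : ∀ k : Fin 3, dVol ![EuclideanSpace.single k 1, EuclideanSpace.single (k + 1) 1,
      EuclideanSpace.single (k + 2) 1] = 1 := by
    intro k
    rw [dVol_apply]
    fin_cases k <;> simp [cross_apply, dotProduct]
  -- In the order of `splitPerm`, only the identity shuffle contributes to both wedge products.
  have hperm := (wedge (wedge a b) γ).map_perm (fun k => A (frame k)) (splitPerm i j)
  rw [sign_splitPerm, one_smul] at hperm
  rw [← hperm]
  have hlist : ((fun k => A (frame k)) ∘ splitPerm i j : Fin 6 → Amb) =
      ![A (EuclideanSpace.single (i + 1) 1, 0), A (EuclideanSpace.single (i + 2) 1, 0),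
        A (0, EuclideanSpace.single (j + 1) 1), A (0, EuclideanSpace.single (j + 2) 1),
        A (EuclideanSpace.single i 1, 0), A (0, EuclideanSpace.single j 1)] := by
    rw [coe_splitPerm]
    funext k
    fin_cases k <;> simp [frame_castAdd, frame_addNat]
  rw [hlist, wedge_apply_of_annihilates (p := 2 + 2) (q := 2),
    wedge_apply_of_annihilates (p := 2) (q := 2)]
  · have h1 : a ![A (EuclideanSpace.single (i + 1) 1, 0), A (EuclideanSpace.single (i + 2) 1, 0)]
        = 1 := by
      rw [ha, AlternatingMap.compLinearMap_apply, AlternatingMap.curryLeft_apply_apply]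
      refine Eq.trans ?_ (hvol i)
      refine congrArg dVol (funext fun k => ?_)
      fin_cases k <;> simp [hX]
    have h2 : b ![A (0, EuclideanSpace.single (j + 1) 1), A (0, EuclideanSpace.single (j + 2) 1)]
        = 1 := by
      rw [hb, AlternatingMap.compLinearMap_apply, AlternatingMap.curryLeft_apply_apply]
      refine Eq.trans ?_ (hvol j)
      refine congrArg dVol (funext fun k => ?_)
      fin_cases k <;> simp [hY]
    have h3 : ∀ (f : Amb [⋀^Fin 2]→ₗ[ℝ] ℝ) (u : Fin 2 → Amb), f u = f ![u 0, u 1] := by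
      intro f u
      refine congrArg f (funext fun k => ?_)
      fin_cases k <;> rfl
    rw [h3 a, h3 b, h3 γ]
    exact (congrArg₂ (· * ·) (congrArg₂ (· * ·) h1 h2) rfl).trans
      (by rw [one_mul, one_mul]; rfl)
  · intro k
    fin_cases k
    exacts [hay _, hay _]
  · intro k
    fin_cases k
    exacts [hax.wedge (hbx _), (hay _).wedge hby]

/-- The value of `dVol (v, ·, ·) ∧ dVol (w, ·, ·) ∧ γ` on the standard frame only sees the mixed
part of the two-form `γ`.  Both sides are bilinear in `(v, w)`. -/
theorem wedge_wedge_section (A : E3 × E3 →ₗ[ℝ] Amb) (hX : ∀ t, projX (A t) = t.1)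
    (hY : ∀ t, projY (A t) = t.2) (v w : E3) (γ : Amb [⋀^Fin 2]→ₗ[ℝ] ℝ) :
    wedge (wedge ((dVol.curryLeft v).compLinearMap projX)
      ((dVol.curryLeft w).compLinearMap projY)) γ (fun i => A (frame i)) =
      γ ![A (v, 0), A (0, w)] := by
  have smul_comp : ∀ (c : ℝ) (f : E3 [⋀^Fin 2]→ₗ[ℝ] ℝ) (L : Amb →ₗ[ℝ] E3),
      (c • f).compLinearMap L = c • f.compLinearMap L := fun _ _ _ => rfl
  let F : E3 →ₗ[ℝ] E3 →ₗ[ℝ] ℝ := LinearMap.mk₂ ℝ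
    (fun v w => wedge (wedge ((dVol.curryLeft v).compLinearMap projX)
      ((dVol.curryLeft w).compLinearMap projY)) γ (fun i => A (frame i)))
    (fun v v' w => by
      rw [map_add, AlternatingMap.add_compLinearMap, wedge_add_left, wedge_add_left,
        AlternatingMap.add_apply])
    (fun c v w => by
      rw [map_smul, smul_comp, wedge_smul_left, wedge_smul_left, AlternatingMap.smul_apply])
    (fun v w w' => by
      rw [map_add, AlternatingMap.add_compLinearMap, wedge_add_right, wedge_add_left,
        AlternatingMap.add_apply])
    (fun c v w => by
      rw [map_smul, smul_comp, wedge_smul_right, wedge_smul_left, AlternatingMap.smul_apply])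
  let iX : E3 →ₗ[ℝ] Amb := A ∘ₗ LinearMap.inl ℝ E3 E3
  let iY : E3 →ₗ[ℝ] Amb := A ∘ₗ LinearMap.inr ℝ E3 E3
  have hiX : ∀ v, iX v = A (v, 0) := fun _ => rfl
  have hiY : ∀ w, iY w = A (0, w) := fun _ => rfl
  have hcons : ∀ x y : Amb, γ ![x, y] = γ.curryLeft x ![y] := fun _ _ => rfl
  let G : E3 →ₗ[ℝ] E3 →ₗ[ℝ] ℝ := LinearMap.mk₂ ℝ (fun v w => γ ![iX v, iY w])
    (fun v v' w => by simp only [map_add, hcons, AlternatingMap.add_apply])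
    (fun c v w => by simp only [map_smul, hcons, AlternatingMap.smul_apply])
    (fun v w w' => by simp only [map_add, hcons]; exact (γ.curryLeft (iX v)).map_vecCons_add _ _ _)
    (fun c v w => by simp only [map_smul, hcons]; exact (γ.curryLeft (iX v)).map_vecCons_smul _ _ _)
  have hFG : F = G := by
    refine (EuclideanSpace.basisFun (Fin 3) ℝ).toBasis.ext fun i =>
      (EuclideanSpace.basisFun (Fin 3) ℝ).toBasis.ext fun j => ?_
    simp only [OrthonormalBasis.coe_toBasis, EuclideanSpace.basisFun_apply]
    rw [LinearMap.mk₂_apply, LinearMap.mk₂_apply, hiX, hiY]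
    convert wedge_wedge_section_single A hX hY i j γ
  have h := congrArg (fun H : E3 →ₗ[ℝ] E3 →ₗ[ℝ] ℝ => H v w) hFG
  simp only [F, G, LinearMap.mk₂_apply] at h
  rwa [hiX, hiY] at h

/-! ### The configuration space away from the diagonal -/

theorem isOpen_C2Open_univ : IsOpen (C2Open univ) := by
  have : C2Open univ = {p : E3 × E3 | p.1 ≠ p.2} := by simp [C2Open]
  rw [this]
  exact isOpen_ne_fun continuous_fst continuous_snd

theorem mem_C2Open_univ {p : E3 × E3} : p ∈ C2Open univ ↔ p.1 ≠ p.2 := by simp [C2Open]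

theorem hasFDerivAt_dir {v : E3} (hv : v ≠ 0) :
    ∃ c : E3 →L[ℝ] ℝ,
      HasFDerivAt dir (‖v‖⁻¹ • ContinuousLinearMap.id ℝ E3 + c.smulRight v) v := by
  have h : DifferentiableAt ℝ (fun w : E3 => ‖w‖⁻¹) v :=
    ((contDiffAt_norm ℝ hv (n := 1)).differentiableAt one_ne_zero).inv (norm_ne_zero_iff.2 hv)
  exact ⟨_, h.hasFDerivAt.smul (hasFDerivAt_id v)⟩

theorem norm_dir {v : E3} (hv : v ≠ 0) : ‖dir v‖ = 1 := by
  rw [dir, norm_smul, norm_inv, norm_norm, inv_mul_cancel₀ (norm_ne_zero_iff.2 hv)]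

theorem dir_neg (v : E3) : dir (-v) = -dir v := by simp [dir]

theorem norm_smul_dir (v : E3) : ‖v‖ • dir v = v := by
  rcases eq_or_ne v 0 with rfl | hv
  · simp
  · rw [dir, smul_smul, mul_inv_cancel₀ (norm_ne_zero_iff.2 hv), one_smul]

theorem dir_smul {r : ℝ} (hr : 0 < r) (v : E3) : dir (r • v) = dir v := by
  rw [dir, dir, norm_smul, Real.norm_of_nonneg hr.le, smul_smul, mul_inv_rev, mul_assoc,
    inv_mul_cancel₀ hr.ne', mul_one]

theorem dir_of_norm_eq_one {v : E3} (hv : ‖v‖ = 1) : dir v = v := by simp [dir, hv]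

theorem differentiableAt_iota {p : E3 × E3} (hp : p.1 ≠ p.2) : DifferentiableAt ℝ iota p := by
  obtain ⟨c, hc⟩ := hasFDerivAt_dir (sub_ne_zero.2 hp)
  obtain ⟨c', hc'⟩ := hasFDerivAt_dir (sub_ne_zero.2 hp.symm)
  have h1 : DifferentiableAt ℝ (fun p : E3 × E3 => dir (p.1 - p.2)) p :=
    DifferentiableAt.comp (g := dir) p hc.differentiableAt
      (differentiableAt_fst.sub differentiableAt_snd)
  have h2 : DifferentiableAt ℝ (fun p : E3 × E3 => dir (p.2 - p.1)) p :=
    DifferentiableAt.comp (g := dir) p hc'.differentiableAt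
      (differentiableAt_snd.sub differentiableAt_fst)
  exact differentiableAt_fst.prodMk (differentiableAt_snd.prodMk (h1.prodMk h2))

theorem projX_fderiv_iota {p : E3 × E3} (hp : p.1 ≠ p.2) (t : E3 × E3) :
    projX ((fderiv ℝ iota p).toLinearMap t) = t.1 := by
  have h := (differentiableAt_iota hp).hasFDerivAt
  have h1 : HasFDerivAt (fun p : E3 × E3 => p.1) _ p := h.fst
  rw [show projX ((fderiv ℝ iota p).toLinearMap t) =
    ((ContinuousLinearMap.fst ℝ E3 (E3 × E3 × E3)).comp (fderiv ℝ iota p)) t from rfl, h1.unique hasFDerivAt_fst]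
  rfl

theorem projY_fderiv_iota {p : E3 × E3} (hp : p.1 ≠ p.2) (t : E3 × E3) :
    projY ((fderiv ℝ iota p).toLinearMap t) = t.2 := by
  have h := (differentiableAt_iota hp).hasFDerivAt
  have h1 : HasFDerivAt (fun p : E3 × E3 => p.2) _ p := h.snd.fst
  rw [show projY ((fderiv ℝ iota p).toLinearMap t) = ((ContinuousLinearMap.fst ℝ E3 (E3 × E3)).comp
    ((ContinuousLinearMap.snd ℝ E3 (E3 × E3 × E3)).comp (fderiv ℝ iota p))) t from rfl,
    h1.unique hasFDerivAt_snd]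
  rfl

/-- The derivative of the Gauss map, up to a multiple of `y - x`, which the area form at
`(y - x) / |y - x|` does not see. -/
theorem gauss_fderiv_iota {p : E3 × E3} (hp : p.1 ≠ p.2) :
    ∃ c : E3 → ℝ, ∀ t : E3 × E3, gauss (fderiv ℝ iota p t) =
      ‖p.2 - p.1‖⁻¹ • (t.2 - t.1) + c (t.2 - t.1) • (p.2 - p.1) := by
  obtain ⟨c, hc⟩ := hasFDerivAt_dir (sub_ne_zero.2 hp.symm)
  refine ⟨c, fun t => ?_⟩
  have h := (differentiableAt_iota hp).hasFDerivAt
  have h1 : HasFDerivAt (fun p : E3 × E3 => dir (p.2 - p.1)) _ p := h.snd.snd.snd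
  have h2 : HasFDerivAt (fun p : E3 × E3 => dir (p.2 - p.1)) _ p :=
    HasFDerivAt.comp (g := dir) p hc (hasFDerivAt_snd.sub hasFDerivAt_fst)
  have h3 := congrArg (fun L : E3 × E3 →L[ℝ] E3 => L t) (h1.unique h2)
  exact h3.trans rfl

/-- A form of degree six, in the coordinates `(x, y)` of the open configuration space. -/
theorem coeff_iota (η : Amb → Amb [⋀^Fin 6]→ₗ[ℝ] ℝ) {p : E3 × E3} (hp : p.1 ≠ p.2) :
    coeff η (C2Open univ) iota p =
      η (iota p) (fun i => (fderiv ℝ iota p).toLinearMap (frame i)) := by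
  rw [coeff, fderivWithin_of_isOpen isOpen_C2Open_univ (mem_C2Open_univ.2 hp)]
  rfl

set_option maxRecDepth 4000 in
theorem coeff_volXY_iota {p : E3 × E3} (hp : p.1 ≠ p.2) :
    coeff (fun _ => volXY) (C2Open univ) iota p = 1 := by
  rw [coeff_iota _ hp]
  exact volXY_section _ (projX_fderiv_iota hp) (projY_fderiv_iota hp)

theorem unitArea_gauss {v a b : E3} (c d : ℝ) :
    unitArea (dir v) ![‖v‖⁻¹ • a + c • v, ‖v‖⁻¹ • b + d • v] =
      1 / (4 * Real.pi) * (dVol ![v, a, b] / ‖v‖ ^ 3) := by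
  change 1 / (4 * Real.pi) * dVol ![dir v, ‖v‖⁻¹ • a + c • v, ‖v‖⁻¹ • b + d • v] = _
  congr 1
  rw [dVol_apply, dVol_apply, div_eq_mul_inv, ← inv_pow]
  simp only [dir, cross_apply, dotProduct, Fin.sum_univ_three, PiLp.smul_apply, PiLp.add_apply,
    smul_eq_mul, Matrix.cons_val]
  ring

theorem toAlternatingMap_eq_curryLeft {α : E3 → E3 [⋀^Fin 2]→L[ℝ] ℝ} {v x : E3}
    (h : ∀ W₁ W₂ : E3, α x ![W₁, W₂] = dVol ![v, W₁, W₂]) :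
    (α x).toAlternatingMap = dVol.curryLeft v := by
  ext m
  have hm : m = ![m 0, m 1] := by
    funext i; fin_cases i <;> rfl
  rw [hm]
  exact h _ _

set_option maxRecDepth 4000 in
/-- On the open configuration space, `Φ` is the classical helicity integrand times
`dVol_x ∧ dVol_y / 4π`. -/
theorem coeff_Phi_iota {Ω : Set E3} {α : E3 → E3 [⋀^Fin 2]→L[ℝ] ℝ} {V : E3 → E3}
    (hV : ∀ x ∈ Ω, ∀ W₁ W₂ : E3, α x ![W₁, W₂] = dVol ![V x, W₁, W₂])
    {p : E3 × E3} (hp : p ∈ C2Open Ω) :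
    coeff (Phi α) (C2Open univ) iota p = 1 / (4 * Real.pi) * classicalIntegrand V p := by
  obtain ⟨h1, h2, hne⟩ := hp
  rw [coeff_iota _ hne, Phi, formX, formY, projX_iota, projY_iota,
    toAlternatingMap_eq_curryLeft (hV _ h1), toAlternatingMap_eq_curryLeft (hV _ h2)]
  refine (wedge_wedge_section _ (projX_fderiv_iota hne) (projY_fderiv_iota hne) _ _ _).trans ?_
  obtain ⟨c, hc⟩ := gauss_fderiv_iota hne
  have hu : gauss (iota p) = dir (p.2 - p.1) := rfl
  rw [gaussForm, AlternatingMap.compLinearMap_apply, hu]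
  have hlist : (fun i => gauss ((![(fderiv ℝ iota p).toLinearMap (V p.1, 0),
      (fderiv ℝ iota p).toLinearMap (0, V p.2)] : Fin 2 → Amb) i)) =
      ![‖p.2 - p.1‖⁻¹ • (0 - V p.1) + c (0 - V p.1) • (p.2 - p.1),
        ‖p.2 - p.1‖⁻¹ • (V p.2 - 0) + c (V p.2 - 0) • (p.2 - p.1)] := by
    funext i
    fin_cases i
    · exact hc (V p.1, 0)
    · exact hc (0, V p.2)
  refine (congrArg _ hlist).trans ?_
  rw [unitArea_gauss, classicalIntegrand, norm_sub_rev p.2 p.1, dVol_apply]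
  congr 2
  simp only [cross_apply, dotProduct, Fin.sum_univ_three, PiLp.sub_apply, PiLp.zero_apply,
    Matrix.cons_val]
  ring

/-! ### Points of the compactification -/

/-- On `C₂[ℝ³]` the two directions are opposite unit vectors, and `y - x` is a nonnegative multiple
of the second. -/
theorem C2_univ_subset : C2 univ ⊆ {q : Amb | q.2.2.1 = -q.2.2.2 ∧ ‖q.2.2.2‖ = 1 ∧
    q.2.1 - q.1 = ‖q.2.1 - q.1‖ • q.2.2.2} := by
  refine inter_subset_right.trans (closure_minimal ?_ ?_)
  · rintro _ ⟨p, ⟨-, -, hp⟩, rfl⟩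
    refine ⟨?_, norm_dir (sub_ne_zero.2 hp.symm), (norm_smul_dir _).symm⟩
    change dir (p.1 - p.2) = -dir (p.2 - p.1)
    rw [← dir_neg, neg_sub]
  · refine IsClosed.inter (isClosed_eq (by fun_prop) (by fun_prop)) (IsClosed.inter ?_ ?_)
    · exact isClosed_eq (by fun_prop) (by fun_prop)
    · exact isClosed_eq (by fun_prop) (by fun_prop)

theorem sub_eq_norm_smul_of_mem_C2 {q : Amb} (hq : q ∈ C2 univ) :
    q.1 - q.2.1 = ‖q.2.1 - q.1‖ • q.2.2.1 := by
  obtain ⟨h1, -, h3⟩ := C2_univ_subset hq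
  rw [h1, smul_neg, ← h3, neg_sub]

theorem C2_mono {Ω Ω' : Set E3} (h : Ω ⊆ Ω') : C2 Ω ⊆ C2 Ω' :=
  inter_subset_inter (prod_mono h (prod_mono h subset_rfl))
    (closure_mono (image_mono fun _ hp => ⟨h hp.1, h hp.2.1, hp.2.2⟩))

theorem iota_eq_of_mem_C2 {q : Amb} (hq : q ∈ C2 univ) (hne : q.1 ≠ q.2.1) :
    iota (q.1, q.2.1) = q := by
  obtain ⟨h1, h2, h3⟩ := C2_univ_subset hq
  have h4 : dir (q.2.1 - q.1) = q.2.2.2 := by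
    rw [h3, dir_smul (norm_pos_iff.2 (sub_ne_zero.2 hne.symm)), dir_of_norm_eq_one h2]
  have h5 : dir (q.1 - q.2.1) = q.2.2.1 := by rw [← neg_sub, dir_neg, h4, h1]
  obtain ⟨x, y, u, v⟩ := q
  simp only at h4 h5
  simp only [iota, h4, h5]

theorem iota_mem_C2 {Ω : Set E3} {p : E3 × E3} (hp : p ∈ C2Open Ω) : iota p ∈ C2 Ω :=
  ⟨⟨hp.1, hp.2.1, mem_sphere_zero_iff_norm.2 (norm_dir (sub_ne_zero.2 hp.2.2)),
    mem_sphere_zero_iff_norm.2 (norm_dir (sub_ne_zero.2 hp.2.2.symm))⟩, subset_closure ⟨p, hp, rfl⟩⟩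

theorem isClosed_C2 {Ω : Set E3} (hΩ : IsClosed Ω) : IsClosed (C2 Ω) :=
  (hΩ.prod (hΩ.prod (Metric.isClosed_sphere.prod Metric.isClosed_sphere))).inter isClosed_closure

/-! ### Oriented parametrizations in the coordinates `(x, y)` -/

/-- The projection of the ambient space onto the two points `(x, y)`. -/
def xy : Amb →L[ℝ] E3 × E3 :=
  (ContinuousLinearMap.fst ℝ E3 (E3 × E3 × E3)).prod
    ((ContinuousLinearMap.fst ℝ E3 (E3 × E3)).comp (ContinuousLinearMap.snd ℝ E3 (E3 × E3 × E3)))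

theorem xy_iota (p : E3 × E3) : xy (iota p) = p := rfl

theorem uniqueDiffOn_halfSpace : UniqueDiffOn ℝ halfSpace := by
  have hconv : Convex ℝ halfSpace := by
    have : halfSpace = ((EuclideanSpace.proj (0 : Fin 3)).comp
        (ContinuousLinearMap.fst ℝ E3 E3)).toLinearMap ⁻¹' Ici (0 : ℝ) := rfl
    rw [this]
    exact (convex_Ici 0).linear_preimage _
  refine uniqueDiffOn_convex hconv ⟨(EuclideanSpace.single 0 1, 0), ?_⟩
  refine mem_interior.2 ⟨{t | 0 < t.1 0}, fun t (ht : 0 < t.1 0) => ht.le, ?_, by simp⟩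
  exact isOpen_lt continuous_const (by fun_prop)

instance : (volume : Measure (E3 × E3)).IsAddHaarMeasure :=
  inferInstanceAs ((volume : Measure E3).prod (volume : Measure E3)).IsAddHaarMeasure

theorem volume_boundary_halfSpace : volume {t : E3 × E3 | t.1 0 = 0} = 0 := by
  let ℓ : E3 × E3 →ₗ[ℝ] ℝ := ((EuclideanSpace.proj (0 : Fin 3)).comp
        (ContinuousLinearMap.fst ℝ E3 E3)).toLinearMap
  refine Measure.addHaar_submodule volume (LinearMap.ker ℓ) fun h => ?_
  have h1 : ((EuclideanSpace.single 0 1, 0) : E3 × E3) ∈ LinearMap.ker ℓ := h ▸ Submodule.mem_top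
  have h2 : ((EuclideanSpace.single 0 1, 0) : E3 × E3).1 0 = 0 := h1
  simp at h2

theorem volume_diagonal : volume {p : E3 × E3 | p.1 = p.2} = 0 := by
  let ℓ : E3 × E3 →ₗ[ℝ] E3 := LinearMap.fst ℝ E3 E3 - LinearMap.snd ℝ E3 E3
  have hs : {p : E3 × E3 | p.1 = p.2} = LinearMap.ker ℓ := by
    ext p
    exact sub_eq_zero.symm
  rw [hs]
  refine Measure.addHaar_submodule volume (LinearMap.ker ℓ) fun h => ?_
  have h1 : ((EuclideanSpace.single 0 1, 0) : E3 × E3) ∈ LinearMap.ker ℓ := h ▸ Submodule.mem_top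
  have h2 : (EuclideanSpace.single 0 1 : E3) - 0 = 0 := h1
  simp at h2

theorem C2Open_ae_eq (Ω : Set E3) : C2Open Ω =ᵐ[volume] Ω ×ˢ Ω := by
  have : C2Open Ω = (Ω ×ˢ Ω) \ {p : E3 × E3 | p.1 = p.2} := by
    ext p
    simp [C2Open, and_assoc]
  rw [this]
  exact sdiff_null_ae_eq_self volume_diagonal

namespace IsOrientedParam

variable {D : Set (E3 × E3)} {φ : E3 × E3 → Amb}

theorem uniqueDiffOn (h : IsOrientedParam D φ) : UniqueDiffOn ℝ D := by
  obtain ⟨U, hU, rfl⟩ := h.relOpen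
  rw [inter_comm]
  exact uniqueDiffOn_halfSpace.inter hU

theorem differentiableOn (h : IsOrientedParam D φ) : DifferentiableOn ℝ φ D :=
  h.smooth.differentiableOn (by simp)

theorem hasFDerivWithinAt_xy (h : IsOrientedParam D φ) {t : E3 × E3} (ht : t ∈ D) :
    HasFDerivWithinAt (fun s => xy (φ s)) (xy.comp (fderivWithin ℝ φ D t)) D t :=
  xy.hasFDerivAt.comp_hasFDerivWithinAt t (h.differentiableOn t ht).hasFDerivWithinAt

/-- Away from the diagonal a parametrization factors through `ι₂`. -/
theorem fderivWithin_eq (h : IsOrientedParam D φ) {t : E3 × E3} (ht : t ∈ D)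
    (hne : (φ t).1 ≠ (φ t).2.1) :
    fderivWithin ℝ φ D t =
      (fderiv ℝ iota (xy (φ t))).comp (xy.comp (fderivWithin ℝ φ D t)) := by
  have h1 := (h.differentiableOn t ht).hasFDerivWithinAt
  have h2 : HasFDerivWithinAt (fun s => iota (xy (φ s))) _ D t :=
    HasFDerivAt.comp_hasFDerivWithinAt (g := iota) (f := fun s => xy (φ s)) t
      (differentiableAt_iota (p := xy (φ t)) hne).hasFDerivAt (h.hasFDerivWithinAt_xy ht)
  have hcont : ContinuousWithinAt (fun s => xy (φ s)) D t :=
    (h.hasFDerivWithinAt_xy ht).continuousWithinAt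
  have hev : ∀ᶠ s in 𝓝[D] t, φ s = iota (xy (φ s)) := by
    filter_upwards [hcont (isOpen_C2Open_univ.mem_nhds (mem_C2Open_univ.2 hne)),
      self_mem_nhdsWithin] with s hs hsD
    exact (iota_eq_of_mem_C2 (h.mapsTo hsD) (mem_C2Open_univ.1 hs)).symm
  exact (h.uniqueDiffOn t ht).eq h1 (h2.congr_of_eventuallyEq hev (hev.self_of_nhdsWithin ht))

set_option maxRecDepth 4000 in
/-- The change-of-coordinates formula for the coefficient of a form of degree six. -/
theorem coeff_eq (h : IsOrientedParam D φ) (η : Amb → Amb [⋀^Fin 6]→ₗ[ℝ] ℝ) {t : E3 × E3}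
    (ht : t ∈ D) (hne : (φ t).1 ≠ (φ t).2.1) :
    coeff η D φ t = coeff η (C2Open univ) iota (xy (φ t)) *
      (xy.comp (fderivWithin ℝ φ D t)).det := by
  rw [coeff_iota η (p := xy (φ t)) hne]
  have := topForm_comp ((η (iota (xy (φ t)))).compLinearMap
    (fderiv ℝ iota (xy (φ t))).toLinearMap) (xy.comp (fderivWithin ℝ φ D t)).toLinearMap
  refine Eq.trans ?_ this
  rw [AlternatingMap.compLinearMap_apply]
  have hφ : iota (xy (φ t)) = φ t := iota_eq_of_mem_C2 (h.mapsTo ht) hne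
  rw [hφ, coeff]
  refine congrArg _ (funext fun i => ?_)
  exact congrArg (fun L : E3 × E3 →L[ℝ] Amb => L (frame i)) (h.fderivWithin_eq ht hne)

theorem det_pos (h : IsOrientedParam D φ) {t : E3 × E3} (ht : t ∈ D)
    (hne : (φ t).1 ≠ (φ t).2.1) : 0 < (xy.comp (fderivWithin ℝ φ D t)).det := by
  have := h.oriented t ht hne
  rwa [h.coeff_eq _ ht hne, coeff_volXY_iota (p := xy (φ t)) hne, one_mul] at this

/-- A parametrization maps interior points of the half-space off the boundary face `x = y`: where
`|y - x|` vanishes at an interior point, it has a minimum, so `d(y - x) = 0` and the derivative has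
rank at most `5`. -/
theorem ne_of_pos (h : IsOrientedParam D φ) {t : E3 × E3} (ht : t ∈ D) (hpos : 0 < t.1 0) :
    (φ t).1 ≠ (φ t).2.1 := by
  intro heq
  obtain ⟨U, hU, hDU⟩ := h.relOpen
  have hD : D ∈ 𝓝 t := by
    rw [hDU]
    refine inter_mem (hU.mem_nhds (hDU ▸ ht).1) ?_
    refine mem_of_superset (IsOpen.mem_nhds (isOpen_lt continuous_const (by fun_prop) :
      IsOpen {s : E3 × E3 | 0 < s.1 0}) hpos) fun s (hs : 0 < s.1 0) => hs.le
  have hinj := h.immersion t ht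
  rw [fderivWithin_of_mem_nhds hD] at hinj
  have hd : HasFDerivAt φ (fderiv ℝ φ t) t :=
    ((h.differentiableOn t ht).differentiableAt hD).hasFDerivAt
  set L := fderiv ℝ φ t
  have hx := hd.fst
  have hy := hd.snd.fst
  have hv := hd.snd.snd.fst
  have hu := hd.snd.snd.snd
  have hC : ∀ᶠ s in 𝓝 t, φ s ∈ C2 univ := mem_of_superset hD h.mapsTo
  have hvu := hv.unique (hu.neg.congr_of_eventuallyEq
    (hC.mono fun s hs => (C2_univ_subset hs).1))
  set Lx := (ContinuousLinearMap.fst ℝ E3 (E3 × E3 × E3)).comp L with hLx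
  set Ly := (ContinuousLinearMap.fst ℝ E3 (E3 × E3)).comp
    ((ContinuousLinearMap.snd ℝ E3 (E3 × E3 × E3)).comp L) with hLy
  set Lu := (ContinuousLinearMap.snd ℝ E3 E3).comp ((ContinuousLinearMap.snd ℝ E3 (E3 × E3)).comp
    ((ContinuousLinearMap.snd ℝ E3 (E3 × E3 × E3)).comp L)) with hLu
  -- `ρ = ⟨y - x, u⟩ = |y - x|` is smooth up to the boundary face.
  set ρ : E3 × E3 → ℝ := fun s => inner ℝ ((φ s).2.1 - (φ s).1) (φ s).2.2.2 with hρ_def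
  have hρ_norm : ∀ {s}, φ s ∈ C2 univ → ρ s = ‖(φ s).2.1 - (φ s).1‖ := by
    intro s hs
    obtain ⟨-, h2, h3⟩ := C2_univ_subset hs
    rw [hρ_def]
    simp only
    rw [h3, real_inner_smul_left, real_inner_self_eq_norm_sq, h2, norm_smul, h2, norm_norm]
    ring
  have hρt : ρ t = 0 := by rw [hρ_norm hC.self_of_nhds, heq, sub_self, norm_zero]
  have hρ : HasFDerivAt ρ _ t := (hy.sub hx).inner ℝ hu
  have hmin : IsLocalMin ρ t := hC.mono fun s hs => by
    rw [hρt, hρ_norm hs]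
    exact norm_nonneg _
  have hw := (hρ.smul hu).congr_of_eventuallyEq (f₁ := fun s => (φ s).2.1 - (φ s).1)
    (hC.mono fun s hs => by
      simp only [Pi.smul_apply', hρ_norm hs]
      exact (C2_univ_subset hs).2.2)
  have hw0 := (hy.sub hx).unique hw
  rw [hmin.hasFDerivAt_eq_zero hρ, hρt] at hw0
  have hxy : ∀ s, Ly s = Lx s := fun s => sub_eq_zero.1
    ((congrArg (fun A : E3 × E3 →L[ℝ] E3 => A s) hw0).trans (by simp))
  have huu : ∀ s, inner ℝ (φ t).2.2.2 (Lu s) = 0 := by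
    have h1 : HasFDerivAt (fun s => inner ℝ (φ s).2.2.2 (φ s).2.2.2 : E3 × E3 → ℝ) _ t :=
      hu.inner ℝ hu
    have h2 := h1.unique ((hasFDerivAt_const (1 : ℝ) t).congr_of_eventuallyEq
      (hC.mono fun s hs => by
        simp only
        rw [real_inner_self_eq_norm_sq, (C2_univ_subset hs).2.1, one_pow]))
    intro s
    have h3 := congrArg (fun A : E3 × E3 →L[ℝ] ℝ => A s) h2
    simp only [ContinuousLinearMap.comp_apply, fderivInnerCLM_apply,
      ContinuousLinearMap.prod_apply, zero_apply] at h3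
    rw [real_inner_comm (φ t).2.2.2 (Lu s)] at h3
    linarith
  -- The derivative is determined by `(dx, du)`, hence these are linear coordinates of `ℝ⁶`.
  have hG : Function.Injective (Lx.prod Lu).toLinearMap := by
    intro s s' hs
    have hs' : (Lx s, Lu s) = (Lx s', Lu s') := hs
    obtain ⟨h1, h2⟩ := Prod.mk.inj hs'
    apply hinj
    refine Prod.ext h1 (Prod.ext ?_ (Prod.ext ?_ h2))
    · exact (hxy s).trans (h1.trans (hxy s').symm)
    · refine (congrArg (fun A : E3 × E3 →L[ℝ] E3 => A s) hvu).trans (Eq.trans ?_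
        (congrArg (fun A : E3 × E3 →L[ℝ] E3 => A s') hvu).symm)
      exact congrArg Neg.neg h2
  obtain ⟨s, hs⟩ := LinearMap.injective_iff_surjective.1 hG (0, (φ t).2.2.2)
  have hs' : (Lx s, Lu s) = (0, (φ t).2.2.2) := hs
  have h1 : Lu s = (φ t).2.2.2 := (Prod.mk.inj hs').2
  have h2 := huu s
  rw [h1, real_inner_self_eq_norm_sq, (C2_univ_subset hC.self_of_nhds).2.1] at h2
  norm_num at h2

theorem measurableSet_offDiag (h : IsOrientedParam D φ) {T : Set (E3 × E3)} (hTD : T ⊆ D)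
    (hT : MeasurableSet T) : MeasurableSet (T ∩ {t | (φ t).1 ≠ (φ t).2.1}) := by
  have hc : ContinuousOn (fun t => xy (φ t)) T :=
    xy.continuous.comp_continuousOn (h.differentiableOn.continuousOn.mono hTD)
  obtain ⟨U, hU, hUT⟩ := continuousOn_iff'.1 hc _ isOpen_C2Open_univ
  have : T ∩ {t | (φ t).1 ≠ (φ t).2.1} = U ∩ T := by
    rw [← hUT, inter_comm]
    congr 1
    ext t
    exact (mem_C2Open_univ (p := xy (φ t))).symm
  rw [this]
  exact hU.measurableSet.inter hT

theorem offDiag_ae_eq (h : IsOrientedParam D φ) {T : Set (E3 × E3)} (hTD : T ⊆ D) :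
    (T ∩ {t | (φ t).1 ≠ (φ t).2.1} : Set (E3 × E3)) =ᵐ[volume] T := by
  have : T ∩ {t | (φ t).1 ≠ (φ t).2.1} = T \ (T ∩ {t | (φ t).1 = (φ t).2.1}) := by
    ext t
    simp only [mem_inter_iff, mem_ofPred_eq, Set.mem_sdiff]
    tauto
  rw [this]
  refine sdiff_null_ae_eq_self (measure_mono_null ?_ volume_boundary_halfSpace)
  rintro t ⟨ht, heq⟩
  have hD := hTD ht
  obtain ⟨U, hU, rfl⟩ := h.relOpen
  have h0 : 0 ≤ t.1 0 := hD.2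
  by_contra hne
  exact h.ne_of_pos hD (lt_of_le_of_ne h0 (Ne.symm hne)) heq

theorem injOn_xy (h : IsOrientedParam D φ) :
    InjOn (fun t => xy (φ t)) (D ∩ {t | (φ t).1 ≠ (φ t).2.1}) := by
  rintro t ⟨ht, hne⟩ s ⟨hs, hne'⟩ hts
  refine h.injOn ht hs ?_
  rw [← iota_eq_of_mem_C2 (h.mapsTo ht) hne, ← iota_eq_of_mem_C2 (h.mapsTo hs) hne']
  exact congrArg iota hts

/-- Change of variables to the coordinates `(x, y)`, for a positively homogeneous transform `g` of
the coefficient; the identity and the absolute value are the cases of interest. -/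
theorem change_of_variables (h : IsOrientedParam D φ) {T : Set (E3 × E3)} (hTD : T ⊆ D)
    (hT : MeasurableSet T) {η : Amb → Amb [⋀^Fin 6]→ₗ[ℝ] ℝ} {F : E3 × E3 → ℝ} (g : ℝ → ℝ)
    (hg : ∀ c a : ℝ, 0 < c → g (c * a) = c * g a)
    (hF : ∀ t ∈ T, (φ t).1 ≠ (φ t).2.1 → coeff η (C2Open univ) iota (xy (φ t)) = F (xy (φ t))) :
    (IntegrableOn (fun p => g (F p))
        ((fun t => xy (φ t)) '' (T ∩ {t | (φ t).1 ≠ (φ t).2.1})) ↔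
      IntegrableOn (fun t => g (coeff η D φ t)) T) ∧
    ∫ p in (fun t => xy (φ t)) '' (T ∩ {t | (φ t).1 ≠ (φ t).2.1}), g (F p) =
      ∫ t in T, g (coeff η D φ t) := by
  have hmeas := h.measurableSet_offDiag hTD hT
  have hderiv : ∀ t ∈ T ∩ {t | (φ t).1 ≠ (φ t).2.1}, HasFDerivWithinAt (fun s => xy (φ s))
      (xy.comp (fderivWithin ℝ φ D t)) (T ∩ {t | (φ t).1 ≠ (φ t).2.1}) t := fun t ht =>
    (h.hasFDerivWithinAt_xy (hTD ht.1)).mono (inter_subset_left.trans hTD)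
  have hinj : InjOn (fun t => xy (φ t)) (T ∩ {t | (φ t).1 ≠ (φ t).2.1}) :=
    h.injOn_xy.mono (inter_subset_inter_left _ hTD)
  have hval : ∀ t ∈ T ∩ {t | (φ t).1 ≠ (φ t).2.1},
      |(xy.comp (fderivWithin ℝ φ D t)).det| • g (F (xy (φ t))) = g (coeff η D φ t) := by
    rintro t ⟨ht, hne⟩
    have hpos := h.det_pos (hTD ht) hne
    rw [h.coeff_eq η (hTD ht) hne, hF t ht hne, abs_of_pos hpos, smul_eq_mul, ← hg _ _ hpos,
      mul_comm]
  constructor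
  · rw [integrableOn_image_iff_integrableOn_abs_det_fderiv_smul volume hmeas hderiv hinj,
      integrableOn_congr_fun hval hmeas]
    exact integrableOn_congr_set_ae (h.offDiag_ae_eq hTD)
  · rw [integral_image_eq_integral_abs_det_fderiv_smul volume hmeas hderiv hinj,
      setIntegral_congr_fun hmeas hval]
    exact setIntegral_congr_set (h.offDiag_ae_eq hTD)

end IsOrientedParam

/-! ### Integration over a cutting -/

/-- If the coefficient of `η` in the coordinates `(x, y)` is an integrable function `F`, then every
cutting of `C₂[Ω]` computes the integral of `F`. -/
theorem IsCutting.hasSum {Ω : Set E3} {η : Amb → Amb [⋀^Fin 6]→ₗ[ℝ] ℝ} {F : E3 × E3 → ℝ}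
    (hηF : ∀ p ∈ C2Open Ω, coeff η (C2Open univ) iota p = F p) (hF : IntegrableOn F (Ω ×ˢ Ω))
    {D T : ℕ → Set (E3 × E3)} {φ : ℕ → E3 × E3 → Amb} (h : IsCutting (C2 Ω) D T φ) :
    (∀ i, IntegrableOn (coeff η (D i) (φ i)) (T i)) ∧
      (Summable fun i => ∫ t in T i, |coeff η (D i) (φ i) t|) ∧
      HasSum (fun i => ∫ t in T i, coeff η (D i) (φ i) t) (∫ p in Ω ×ˢ Ω, F p) := by
  set T' : ℕ → Set (E3 × E3) := fun i => T i ∩ {t | (φ i t).1 ≠ (φ i t).2.1}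
  set S : ℕ → Set (E3 × E3) := fun i => (fun t => xy (φ i t)) '' T' i with hS
  have hmem : ∀ i, ∀ t ∈ T i, φ i t ∈ C2 Ω := fun i t ht =>
    h.cover ▸ mem_iUnion.2 ⟨i, t, ht, rfl⟩
  have hC2 : ∀ i, ∀ t ∈ T' i, xy (φ i t) ∈ C2Open Ω := fun i t ht =>
    ⟨(hmem i t ht.1).1.1, (hmem i t ht.1).1.2.1, ht.2⟩
  have hiota : ∀ i, ∀ t ∈ T' i, iota (xy (φ i t)) = φ i t := fun i t ht =>
    iota_eq_of_mem_C2 ((h.param i).mapsTo (h.subset i ht.1)) ht.2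
  have hS_union : ⋃ i, S i = C2Open Ω := by
    refine subset_antisymm (iUnion_subset fun i => ?_) fun p hp => ?_
    · rintro _ ⟨t, ht, rfl⟩
      exact hC2 i t ht
    · have hp' := iota_mem_C2 hp
      rw [← h.cover] at hp'
      obtain ⟨i, t, ht, hti⟩ := mem_iUnion.1 hp'
      refine mem_iUnion.2 ⟨i, t, ⟨ht, ?_⟩, ?_⟩
      · rw [mem_ofPred_eq, hti]
        exact hp.2.2
      · simp only [hti, xy_iota]
  have hS_disj : Pairwise (Function.onFun Disjoint S) := by
    intro i j hij
    refine disjoint_left.2 ?_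
    rintro _ ⟨t, ht, rfl⟩ ⟨s, hs, hst⟩
    refine disjoint_left.1 (h.disjoint hij) ⟨t, ht.1, rfl⟩ ⟨s, hs.1, ?_⟩
    rw [← hiota i t ht, ← hiota j s hs]
    exact congrArg iota hst
  have hS_meas : ∀ i, MeasurableSet (S i) := fun i =>
    measurable_image_of_fderivWithin
      ((h.param i).measurableSet_offDiag (h.subset i) (h.measurable i))
      (fun t ht => ((h.param i).hasFDerivWithinAt_xy (h.subset i ht.1)).mono
        (inter_subset_left.trans (h.subset i)))
      ((h.param i).injOn_xy.mono (inter_subset_inter_left _ (h.subset i)))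
  have hFS : IntegrableOn F (⋃ i, S i) := by
    rw [hS_union]
    exact hF.congr_set_ae (C2Open_ae_eq Ω)
  have hcv := fun i (g : ℝ → ℝ) (hg : ∀ c a : ℝ, 0 < c → g (c * a) = c * g a) =>
    (h.param i).change_of_variables (h.subset i) (h.measurable i) (η := η) (F := F) g hg
      fun t ht hne => hηF _ (hC2 i t ⟨ht, hne⟩)
  refine ⟨fun i => ?_, ?_, ?_⟩
  · exact (hcv i id fun _ _ _ => rfl).1.1 (hFS.mono_set (subset_iUnion S i))
  · have := (hasSum_integral_iUnion hS_meas hS_disj hFS.abs).summable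
    refine this.congr fun i => ?_
    exact ((hcv i abs fun c a hc => by rw [abs_mul, abs_of_pos hc]).2)
  · have := hasSum_integral_iUnion hS_meas hS_disj hFS
    rw [hS_union, setIntegral_congr_set (C2Open_ae_eq Ω)] at this
    rwa [show (fun i => ∫ p in S i, F p) = fun i => ∫ t in T i, coeff η (D i) (φ i) t from
      funext fun i => (hcv i id fun _ _ _ => rfl).2] at this

/-! ### Integrability of the classical integrand -/

/-- In dimension three the kernel `|z|⁻²` is locally integrable: in polar coordinates it cancels
against the Jacobian `r²`. -/
theorem integrable_indicator_inv_norm_sq (R : ℝ) :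
    Integrable ((Metric.closedBall (0 : E3) R).indicator fun z => (‖z‖ ^ 2)⁻¹) := by
  have h := integrable_fun_norm_addHaar (volume : Measure E3)
    (f := (Iic R).indicator fun r : ℝ => (r ^ 2)⁻¹)
  have heq : (fun z : E3 => (Iic R).indicator (fun r : ℝ => (r ^ 2)⁻¹) ‖z‖) =
      (Metric.closedBall (0 : E3) R).indicator fun z => (‖z‖ ^ 2)⁻¹ := by
    funext z
    simp [indicator]
  rw [heq] at h
  refine h.2 ?_
  have : IntegrableOn ((Iic R).indicator fun _ : ℝ => (1 : ℝ)) (Ioi 0) := by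
    rw [IntegrableOn, integrable_indicator_iff measurableSet_Iic, IntegrableOn,
      Measure.restrict_restrict measurableSet_Iic, ← IntegrableOn]
    refine integrableOn_const ?_
    rw [inter_comm, Ioi_inter_Iic]
    simp
  refine this.congr_fun (fun r (hr : 0 < r) => ?_) measurableSet_Ioi
  by_cases hR : r ≤ R
  · simp [hR, finrank_euclideanSpace, hr.ne']
  · simp [hR]

theorem abs_crossProduct_dotProduct_le (a b c : E3) :
    |crossProduct a.ofLp b.ofLp ⬝ᵥ c.ofLp| ≤ 6 * (‖a‖ * ‖b‖ * ‖c‖) := by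
  have key : ∀ i j k : Fin 3, |a i * b j * c k| ≤ ‖a‖ * ‖b‖ * ‖c‖ := by
    intro i j k
    rw [abs_mul, abs_mul]
    have := PiLp.norm_apply_le a i
    have := PiLp.norm_apply_le b j
    have := PiLp.norm_apply_le c k
    simp only [Real.norm_eq_abs] at *
    gcongr
  have h : crossProduct a.ofLp b.ofLp ⬝ᵥ c.ofLp =
      a 1 * b 2 * c 0 - a 2 * b 1 * c 0 + (a 2 * b 0 * c 1 - a 0 * b 2 * c 1) +
        (a 0 * b 1 * c 2 - a 1 * b 0 * c 2) := by
    simp only [cross_apply, dotProduct, Fin.sum_univ_three, Matrix.cons_val]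
    ring
  rw [h, abs_le]
  have h1 := abs_le.1 (key 1 2 0)
  have h2 := abs_le.1 (key 2 1 0)
  have h3 := abs_le.1 (key 2 0 1)
  have h4 := abs_le.1 (key 0 2 1)
  have h5 := abs_le.1 (key 0 1 2)
  have h6 := abs_le.1 (key 1 0 2)
  constructor <;> linarith [h1.1, h1.2, h2.1, h2.2, h3.1, h3.2, h4.1, h4.2, h5.1, h5.2, h6.1, h6.2]

/-- The dual vector field of a continuous form is continuous: its `k`-th component is the value of
the form on `e_{k+1}, e_{k+2}`. -/
theorem continuousOn_dual {Ω : Set E3} {α : E3 → E3 [⋀^Fin 2]→L[ℝ] ℝ} (hα : ContinuousOn α Ω)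
    {V : E3 → E3} (hV : ∀ x ∈ Ω, ∀ W₁ W₂ : E3, α x ![W₁, W₂] = dVol ![V x, W₁, W₂]) :
    ContinuousOn V Ω := by
  have hk : ∀ k : Fin 3, ContinuousOn (fun x => V x k) Ω := by
    intro k
    have h : ContinuousOn (fun x => α x ![EuclideanSpace.single (k + 1) 1,
        EuclideanSpace.single (k + 2) 1]) Ω := by
      have hc : Continuous fun a : E3 [⋀^Fin 2]→L[ℝ] ℝ =>
          a ![EuclideanSpace.single (k + 1) 1, EuclideanSpace.single (k + 2) 1] :=
        (ContinuousAlternatingMap.apply ℝ E3 ℝ _).continuous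
      exact hc.comp_continuousOn hα
    refine h.congr fun x hx => ?_
    refine Eq.trans ?_ (hV x hx _ _).symm
    rw [dVol_apply]
    fin_cases k <;> simp [cross_apply, dotProduct]
  have : V = fun x => WithLp.toLp 2 fun k => V x k := rfl
  rw [this]
  exact (PiLp.continuous_toLp 2 _).comp_continuousOn (continuousOn_pi.2 hk)

/-- The integrand is `O(|x - y|⁻²)`, and this bound is the integrand of a convolution of integrable
functions. -/
theorem integrableOn_classicalIntegrand {Ω : Set E3} (hΩ : IsCompact Ω) {V : E3 → E3}
    (hV : ContinuousOn V Ω) : IntegrableOn (classicalIntegrand V) (Ω ×ˢ Ω) := by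
  obtain ⟨M, hM⟩ := hΩ.exists_bound_of_continuousOn hV
  obtain ⟨R, hR⟩ := (hΩ.prod hΩ).exists_bound_of_continuousOn
    (f := fun p : E3 × E3 => p.1 - p.2) (by fun_prop)
  have hΩm : MeasurableSet Ω := hΩ.measurableSet
  have hC : MeasurableSet (C2Open Ω) := by
    have : C2Open Ω = (Ω ×ˢ Ω) ∩ C2Open univ := by
      ext p
      simp [C2Open, and_assoc]
    rw [this]
    exact (hΩm.prod hΩm).inter isOpen_C2Open_univ.measurableSet
  have hcont : ContinuousOn (classicalIntegrand V) (C2Open Ω) := by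
    have h1 : ContinuousOn (fun p : E3 × E3 => V p.1) (C2Open Ω) :=
      hV.comp continuousOn_fst fun p hp => hp.1
    have h2 : ContinuousOn (fun p : E3 × E3 => V p.2) (C2Open Ω) :=
      hV.comp continuousOn_snd fun p hp => hp.2.1
    have h1' : ∀ k, ContinuousOn (fun p : E3 × E3 => V p.1 k) (C2Open Ω) := fun k =>
      (EuclideanSpace.proj (𝕜 := ℝ) k).continuous.comp_continuousOn h1
    have h2' : ∀ k, ContinuousOn (fun p : E3 × E3 => V p.2 k) (C2Open Ω) := fun k =>
      (EuclideanSpace.proj (𝕜 := ℝ) k).continuous.comp_continuousOn h2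
    refine ContinuousOn.div ?_ (by fun_prop) fun p hp =>
      pow_ne_zero _ (norm_ne_zero_iff.2 (sub_ne_zero.2 hp.2.2))
    simp only [cross_apply, dotProduct, Fin.sum_univ_three, Matrix.cons_val]
    fun_prop
  refine IntegrableOn.congr_set_ae ?_ (C2Open_ae_eq Ω).symm
  have hdom : Integrable (fun p : E3 × E3 => (Ω.indicator (fun _ => 6 * (M * M)) p.2 : ℝ) *
      (Metric.closedBall (0 : E3) R).indicator (fun z => (‖z‖ ^ 2)⁻¹) (p.1 - p.2)) := by
    refine Integrable.convolution_integrand (ContinuousLinearMap.mul ℝ ℝ) ?_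
      (integrable_indicator_inv_norm_sq R)
    exact (integrable_indicator_iff hΩm).2 (integrableOn_const hΩ.measure_lt_top.ne)
  refine Integrable.mono' hdom.integrableOn (hcont.aestronglyMeasurable hC) ?_
  filter_upwards [ae_restrict_mem hC] with p hp
  have hz : 0 < ‖p.1 - p.2‖ := norm_pos_iff.2 (sub_ne_zero.2 hp.2.2)
  have hR' : p.1 - p.2 ∈ Metric.closedBall (0 : E3) R :=
    mem_closedBall_zero_iff.2 (hR p ⟨hp.1, hp.2.1⟩)
  rw [indicator_of_mem hp.2.1, indicator_of_mem hR', classicalIntegrand, Real.norm_eq_abs, abs_div,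
    abs_of_pos (pow_pos hz 3), div_le_iff₀ (pow_pos hz 3)]
  refine (abs_crossProduct_dotProduct_le _ _ _).trans ?_
  have h1 := hM p.1 hp.1
  have h2 := hM p.2 hp.2.1
  have h3 : ‖V p.1‖ * ‖V p.2‖ ≤ M * M :=
    mul_le_mul h1 h2 (norm_nonneg _) ((norm_nonneg _).trans h1)
  calc 6 * (‖V p.1‖ * ‖V p.2‖ * ‖p.1 - p.2‖) ≤ 6 * (M * M * ‖p.1 - p.2‖) := by gcongr
    _ = 6 * (M * M) * (‖p.1 - p.2‖ ^ 2)⁻¹ * ‖p.1 - p.2‖ ^ 3 := by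
      field_simp

/-! ### Charts of the compactified configuration space -/

/-- The norm `1 + a² + b²` of `chartVec`, where `(a, b) = (t₁, t₂)` are the parameters of inverse
stereographic projection. -/
def chartNorm (t : E3 × E3) : ℝ := 1 + t.1 1 ^ 2 + t.1 2 ^ 2

/-- A polynomial vector in the direction of the inverse stereographic projection of
`(a, b) = (t₁, t₂)`, from the south pole for `ε = 1`; for `ε = -1` it is composed with the rotation
by `π` about the first axis, so that the two charts have the same orientation. -/
def chartVec (ε : ℝ) (t : E3 × E3) : E3 :=
  !₂[2 * t.1 1, 2 * ε * t.1 2, ε * (1 - t.1 1 ^ 2 - t.1 2 ^ 2)]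

/-- The chart `(r, a, b, y) ↦ (x, y, u, -u)` of `C₂[ℝ³]`, where `u` is the unit vector with
stereographic parameters `(a, b)` and `x = y + r (1 + a² + b²) u`. -/
noncomputable def chart (ε : ℝ) (t : E3 × E3) : Amb :=
  (t.2 + t.1 0 • chartVec ε t, t.2, (chartNorm t)⁻¹ • chartVec ε t,
    -((chartNorm t)⁻¹ • chartVec ε t))

/-- The inverse of `chart ε`, where `1 + ε u₃ ≠ 0`. -/
noncomputable def chartInv (ε : ℝ) (q : Amb) : E3 × E3 :=
  (!₂[inner ℝ (q.1 - q.2.1) q.2.2.1 * (1 + ε * q.2.2.1 2) / 2,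
    q.2.2.1 0 / (1 + ε * q.2.2.1 2), ε * q.2.2.1 1 / (1 + ε * q.2.2.1 2)], q.2.1)

theorem chartNorm_pos (t : E3 × E3) : 0 < chartNorm t := by
  unfold chartNorm; positivity

theorem inner_chartVec {ε : ℝ} (hε : ε ^ 2 = 1) (t : E3 × E3) :
    inner ℝ (chartVec ε t) (chartVec ε t) = chartNorm t ^ 2 := by
  rw [real_inner_self_eq_norm_sq, EuclideanSpace.real_norm_sq_eq, Fin.sum_univ_three]
  simp [chartVec, chartNorm]
  linear_combination (4 * t.1 2 ^ 2 + (1 - t.1 1 ^ 2 - t.1 2 ^ 2) ^ 2) * hε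

theorem norm_chartVec {ε : ℝ} (hε : ε ^ 2 = 1) (t : E3 × E3) :
    ‖chartVec ε t‖ = chartNorm t := by
  have h := inner_chartVec hε t
  rw [real_inner_self_eq_norm_sq] at h
  exact (pow_left_inj₀ (norm_nonneg _) (chartNorm_pos t).le two_ne_zero).1 h

theorem dir_chartVec {ε : ℝ} (hε : ε ^ 2 = 1) (t : E3 × E3) :
    dir (chartVec ε t) = (chartNorm t)⁻¹ • chartVec ε t := by
  rw [dir, norm_chartVec hε]

theorem norm_inv_smul_chartVec {ε : ℝ} (hε : ε ^ 2 = 1) (t : E3 × E3) :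
    ‖(chartNorm t)⁻¹ • chartVec ε t‖ = 1 := by
  rw [norm_smul, norm_chartVec hε, norm_inv, Real.norm_of_nonneg (chartNorm_pos t).le,
    inv_mul_cancel₀ (chartNorm_pos t).ne']

theorem contDiff_chartNorm : ContDiff ℝ ∞ chartNorm := by
  unfold chartNorm; fun_prop

theorem contDiff_chartVec (ε : ℝ) : ContDiff ℝ ∞ (chartVec ε) := by
  refine contDiff_euclidean.2 fun i => ?_
  fin_cases i <;> simp [chartVec] <;> fun_prop

theorem contDiff_chart (ε : ℝ) : ContDiff ℝ ∞ (chart ε) := by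
  have h1 := contDiff_chartVec ε
  have h2 : ContDiff ℝ ∞ fun t => (chartNorm t)⁻¹ • chartVec ε t :=
    (contDiff_chartNorm.inv fun t => (chartNorm_pos t).ne').smul h1
  have h3 : ContDiff ℝ ∞ fun t : E3 × E3 => t.2 + t.1 0 • chartVec ε t := by fun_prop
  exact h3.prodMk (contDiff_snd.prodMk (h2.prodMk h2.neg))

theorem one_add_chart {ε : ℝ} (hε : ε ^ 2 = 1) (t : E3 × E3) :
    1 + ε * (chart ε t).2.2.1 2 = 2 / chartNorm t := by
  have h := (chartNorm_pos t).ne'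
  have h2 : (chart ε t).2.2.1 2 = (chartNorm t)⁻¹ * (ε * (1 - t.1 1 ^ 2 - t.1 2 ^ 2)) := by
    simp [chart, chartVec]
  rw [h2]
  field_simp
  rw [chartNorm]
  linear_combination (1 - t.1 1 ^ 2 - t.1 2 ^ 2) * hε

theorem chartInv_chart {ε : ℝ} (hε : ε ^ 2 = 1) (t : E3 × E3) : chartInv ε (chart ε t) = t := by
  have h := (chartNorm_pos t).ne'
  rw [chartInv, one_add_chart hε]
  refine Prod.ext ?_ rfl
  have hin : inner ℝ ((chart ε t).1 - (chart ε t).2.1) (chart ε t).2.2.1 =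
      t.1 0 * chartNorm t := by
    simp only [chart]
    rw [add_sub_cancel_left, real_inner_smul_left, real_inner_smul_right, inner_chartVec hε]
    field_simp
  rw [hin]
  ext i
  fin_cases i
  · simp
    field_simp
  · simp [chart, chartVec]
    field_simp
  · simp [chart, chartVec]
    field_simp
    linear_combination t.1 2 * hε

theorem chart_chartInv {ε : ℝ} (hε : ε ^ 2 = 1) {q : Amb} (hq : q ∈ C2 univ)
    (hne : 1 + ε * q.2.2.1 2 ≠ 0) : chart ε (chartInv ε q) = q := by
  obtain ⟨h1, h2, -⟩ := C2_univ_subset hq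
  obtain ⟨x, y, u, v⟩ := q
  simp only at h1 h2 hne
  obtain rfl : v = -u := by rw [h1, neg_neg]
  rw [norm_neg] at h2
  have hu : u 0 ^ 2 + u 1 ^ 2 + u 2 ^ 2 = 1 := by
    have := EuclideanSpace.real_norm_sq_eq u
    rw [h2, Fin.sum_univ_three] at this
    linarith
  have hN : chartNorm (chartInv ε (x, y, u, -u)) = 2 / (1 + ε * u 2) := by
    simp only [chartNorm, chartInv]
    simp
    field_simp
    linear_combination hu + (u 1 ^ 2 + u 2 ^ 2) * hε
  have hvec : chartVec ε (chartInv ε (x, y, u, -u)) = (2 / (1 + ε * u 2)) • u := by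
    ext i
    fin_cases i
    · simp [chartVec, chartInv]
      field_simp
    · simp [chartVec, chartInv]
      field_simp
      linear_combination u 1 * hε
    · simp [chartVec, chartInv]
      field_simp
      linear_combination -ε * hu + (2 * u 2 + ε * u 2 ^ 2 - ε * u 1 ^ 2) * hε
  have hw : (chartNorm (chartInv ε (x, y, u, -u)))⁻¹ •
      chartVec ε (chartInv ε (x, y, u, -u)) = u := by
    rw [hN, hvec, smul_smul, inv_mul_cancel₀ (div_ne_zero two_ne_zero hne), one_smul]
  have hx : x - y = inner ℝ (x - y) u • u := by
    rw [sub_eq_norm_smul_of_mem_C2 hq, real_inner_smul_left, real_inner_self_eq_norm_sq, h2,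
      one_pow, mul_one]
  simp only [chart, hw]
  refine Prod.ext ?_ rfl
  simp only [hvec]
  have : (chartInv ε (x, y, u, -u)).1 0 = inner ℝ (x - y) u * (1 + ε * u 2) / 2 := by
    simp [chartInv]
  rw [this, smul_smul, show inner ℝ (x - y) u * (1 + ε * u 2) / 2 * (2 / (1 + ε * u 2)) =
    inner ℝ (x - y) u by field_simp, ← hx]
  simp [chartInv]

theorem differentiableAt_chartInv {ε : ℝ} {q : Amb} (hne : 1 + ε * q.2.2.1 2 ≠ 0) :
    DifferentiableAt ℝ (chartInv ε) q := by
  refine DifferentiableAt.prodMk ?_ (by fun_prop)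
  refine differentiableAt_euclidean.2 fun i => ?_
  have h : DifferentiableAt ℝ (fun q : Amb => inner ℝ (q.1 - q.2.1) q.2.2.1) q :=
    DifferentiableAt.inner ℝ (by fun_prop) (by fun_prop)
  fin_cases i <;> simp <;> fun_prop (disch := assumption)

/-- A chart has a differentiable left inverse, hence is an immersion. -/
theorem injective_fderiv_chart {ε : ℝ} (hε : ε ^ 2 = 1) (t : E3 × E3) :
    Function.Injective (fderiv ℝ (chart ε) t) := by
  have hne : 1 + ε * (chart ε t).2.2.1 2 ≠ 0 := by
    rw [one_add_chart hε]
    exact div_ne_zero two_ne_zero (chartNorm_pos t).ne'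
  have h1 := (differentiableAt_chartInv hne).hasFDerivAt.comp t
    ((contDiff_chart ε).differentiable (by simp) t).hasFDerivAt
  have h2 : chartInv ε ∘ chart ε = id := funext (chartInv_chart hε)
  rw [h2] at h1
  have h3 := h1.unique (hasFDerivAt_id t)
  exact Function.LeftInverse.injective (g := fderiv ℝ (chartInv ε) (chart ε t)) fun s =>
    congrArg (fun L : E3 × E3 →L[ℝ] E3 × E3 => L s) h3

theorem chart_mem_C2 {ε : ℝ} (hε : ε ^ 2 = 1) {t : E3 × E3} (ht : t ∈ halfSpace) :
    chart ε t ∈ C2 univ := by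
  refine ⟨⟨mem_univ _, mem_univ _, mem_sphere_zero_iff_norm.2 (norm_inv_smul_chartVec hε t),
    mem_sphere_zero_iff_norm.2 ((norm_neg _).trans (norm_inv_smul_chartVec hε t))⟩, ?_⟩
  -- Off the face `r = 0` the chart takes values in the open configuration space; points of the face
  -- are approached along the `r`-axis.
  have hpos : ∀ s : E3 × E3, 0 < s.1 0 → chart ε s ∈ iota '' C2Open univ := by
    intro s hs
    have hw : chartVec ε s ≠ 0 := norm_ne_zero_iff.1 (norm_chartVec hε s ▸ (chartNorm_pos s).ne')
    refine ⟨(s.2 + s.1 0 • chartVec ε s, s.2), mem_C2Open_univ.2 ?_, ?_⟩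
    · simpa using ⟨hs.ne', hw⟩
    · have h1 : s.2 + s.1 0 • chartVec ε s - s.2 = s.1 0 • chartVec ε s := add_sub_cancel_left _ _
      have h2 : s.2 - (s.2 + s.1 0 • chartVec ε s) = -(s.1 0 • chartVec ε s) := by abel
      simp only [iota, chart]
      rw [h2, dir_neg, h1, dir_smul hs, dir_chartVec hε]
  have hc : Continuous fun s : ℝ => chart ε (t + s • frame 0) :=
    (contDiff_chart ε).continuous.comp (by fun_prop)
  have h0 : (0 : ℝ) ∈ closure (Ioi 0) := by simp
  have := map_mem_closure hc h0 fun s (hs : 0 < s) => hpos (t + s • frame 0) ?_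
  · simpa using this
  · have h0 : 0 ≤ t.1 0 := ht
    simp [frame]
    linarith

/-- If `f` is quadratic along a line, its derivative in that direction is the linear coefficient. -/
theorem fderiv_apply_of_quadratic {E F : Type*} [NormedAddCommGroup E] [NormedSpace ℝ E]
    [NormedAddCommGroup F] [NormedSpace ℝ F] {f : E → F} {x v : E} {A B : F}
    (hf : DifferentiableAt ℝ f x) (h : ∀ s : ℝ, f (x + s • v) = f x + s • A + s ^ 2 • B) :
    fderiv ℝ f x v = A := by
  have h1 : HasDerivAt (fun s : ℝ => f (x + s • v)) (fderiv ℝ f x v) 0 :=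
    hf.hasFDerivAt.hasLineDerivAt v
  have h2 : HasDerivAt (fun s : ℝ => f x + s • A + s ^ 2 • B) A 0 := by
    have h3 := (((hasDerivAt_id (0 : ℝ)).smul_const A).const_add (f x)).add
      ((hasDerivAt_pow 2 (0 : ℝ)).smul_const B)
    exact h3.congr_deriv (by simp)
  rw [funext h] at h1
  exact h1.unique h2

/-- The Jacobian of a chart: `x` contributes `det (w, r ∂w/∂a, r ∂w/∂b)`, with `w` the vector
`chartVec`, and `y` is a coordinate of the chart. -/
theorem coeff_volXY_chart {ε : ℝ} (hε : ε ^ 2 = 1) {t : E3 × E3} (ht : t ∈ halfSpace) :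
    coeff (fun _ => volXY) halfSpace (chart ε) t = 4 * chartNorm t * t.1 0 ^ 2 := by
  have hd : DifferentiableAt ℝ (chart ε) t := (contDiff_chart ε).differentiable (by simp) t
  have hX : ∀ v : E3 × E3, projX (fderiv ℝ (chart ε) t v) =
      fderiv ℝ (fun t : E3 × E3 => t.2 + t.1 0 • chartVec ε t) t v := by
    intro v
    have h := hd.hasFDerivAt.fst
    exact (congrArg (fun L : E3 × E3 →L[ℝ] E3 => L v) h.fderiv).symm
  have hY : ∀ v : E3 × E3, projY (fderiv ℝ (chart ε) t v) = v.2 := by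
    intro v
    have h : HasFDerivAt (fun t : E3 × E3 => t.2) _ t := hd.hasFDerivAt.snd.fst
    exact congrArg (fun L : E3 × E3 →L[ℝ] E3 => L v) (h.unique hasFDerivAt_snd)
  have hdX : DifferentiableAt ℝ (fun t : E3 × E3 => t.2 + t.1 0 • chartVec ε t) t :=
    hd.hasFDerivAt.fst.differentiableAt
  have h0 : projX (fderiv ℝ (chart ε) t (frame 0)) = chartVec ε t := by
    rw [hX]
    refine fderiv_apply_of_quadratic (B := 0) hdX fun s => ?_
    ext i
    fin_cases i <;> simp [frame, chartVec] <;> ring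
  have h1 : projX (fderiv ℝ (chart ε) t (frame 1)) = t.1 0 • !₂[2, 0, -2 * ε * t.1 1] := by
    rw [hX]
    refine fderiv_apply_of_quadratic (B := t.1 0 • !₂[0, 0, -ε]) hdX fun s => ?_
    ext i
    fin_cases i <;> simp [frame, chartVec] <;> ring
  have h2 : projX (fderiv ℝ (chart ε) t (frame 2)) = t.1 0 • !₂[0, 2 * ε, -2 * ε * t.1 2] := by
    rw [hX]
    refine fderiv_apply_of_quadratic (B := t.1 0 • !₂[0, 0, -ε]) hdX fun s => ?_
    ext i
    fin_cases i <;> simp [frame, chartVec] <;> ring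
  rw [coeff, fderivWithin_eq_fderiv (uniqueDiffOn_halfSpace t ht) hd]
  simp only [volXY]
  rw [wedge_apply_of_annihilates_right (p := 3) (q := 3)]
  · have hx : (fun i : Fin 3 => projX (fderiv ℝ (chart ε) t (frame (Fin.castAdd 3 i)))) =
        ![chartVec ε t, t.1 0 • !₂[2, 0, -2 * ε * t.1 1],
          t.1 0 • !₂[0, 2 * ε, -2 * ε * t.1 2]] := by
      funext i
      fin_cases i
      exacts [h0, h1, h2]
    have hy : (fun i : Fin 3 => projY (fderiv ℝ (chart ε) t (frame (Fin.natAdd 3 i)))) =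
        fun i => EuclideanSpace.single i 1 := by
      funext i
      rw [hY]
      fin_cases i <;> rfl
    refine (congrArg₂ (· * ·) (congrArg dVol hx) (congrArg dVol hy)).trans ?_
    rw [dVol_basis, mul_one, dVol_apply]
    simp [cross_apply, dotProduct, Fin.sum_univ_three, chartVec, chartNorm]
    linear_combination 4 * t.1 0 ^ 2 * (1 + t.1 1 ^ 2 + t.1 2 ^ 2) * hε
  · intro i
    refine annihilates_comp_of_map_eq_zero _ _ ?_
    rw [hY]
    fin_cases i <;> rfl

theorem isOrientedParam_chart {ε : ℝ} (hε : ε ^ 2 = 1) : IsOrientedParam halfSpace (chart ε) where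
  relOpen := ⟨univ, isOpen_univ, (univ_inter _).symm⟩
  smooth := (contDiff_chart ε).contDiffOn
  injOn := (Function.LeftInverse.injective (chartInv_chart hε)).injOn
  mapsTo := fun _ ht => chart_mem_C2 hε ht
  immersion := fun t ht => by
    rw [fderivWithin_eq_fderiv (uniqueDiffOn_halfSpace t ht)
      ((contDiff_chart ε).differentiable (by simp) t)]
    exact injective_fderiv_chart hε t
  oriented := fun t ht hne => by
    rw [coeff_volXY_chart hε ht]
    have h0 : t.1 0 ≠ 0 := by
      intro h
      refine hne ?_
      change t.2 + t.1 0 • chartVec ε t = t.2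
      rw [h, zero_smul, add_zero]
    have := chartNorm_pos t
    positivity

theorem chartInv_mem_halfSpace {ε : ℝ} (hε : ε ^ 2 = 1) {q : Amb} (hq : q ∈ C2 univ) :
    chartInv ε q ∈ halfSpace := by
  obtain ⟨h1, h2, -⟩ := C2_univ_subset hq
  obtain ⟨x, y, u, v⟩ := q
  simp only at h1 h2
  obtain rfl : v = -u := by rw [h1, neg_neg]
  rw [norm_neg] at h2
  have h5 : 0 ≤ inner ℝ (x - y) u := by
    rw [sub_eq_norm_smul_of_mem_C2 hq, real_inner_smul_left, real_inner_self_eq_norm_sq]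
    positivity
  have h6 : 0 ≤ 1 + ε * u 2 := by
    have := PiLp.norm_apply_le u 2
    rw [h2, Real.norm_eq_abs, ← sq_le_one_iff_abs_le_one] at this
    nlinarith [sq_nonneg (ε + u 2)]
  change 0 ≤ (chartInv ε (x, y, u, -u)).1 0
  simp [chartInv]
  positivity

/-- `C₂[Ω]` is cut by the chart of `ε = 1` and, for the remaining direction of `x - y`, by the slice
`a = b = 0` of the chart of `ε = -1`. -/
theorem exists_isCutting {Ω : Set E3} (hΩ : IsClosed Ω) : ∃ D T φ, IsCutting (C2 Ω) D T φ := by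
  have hp : (1 : ℝ) ^ 2 = 1 := by norm_num
  have hm : (-1 : ℝ) ^ 2 = 1 := by norm_num
  have hhalf : IsClosed halfSpace := isClosed_le continuous_const (by fun_prop)
  have hclosed : ∀ ε, IsClosed (halfSpace ∩ chart ε ⁻¹' C2 Ω) := fun ε =>
    hhalf.inter ((isClosed_C2 hΩ).preimage (contDiff_chart ε).continuous)
  let Z : Set Amb := {q | 1 + q.2.2.1 2 = 0}
  have hZ : IsClosed Z := isClosed_eq (by fun_prop) continuous_const
  let T : ℕ → Set (E3 × E3)
    | 0 => halfSpace ∩ chart 1 ⁻¹' C2 Ω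
    | 1 => (halfSpace ∩ chart (-1) ⁻¹' C2 Ω) ∩ chart (-1) ⁻¹' Z
    | _ + 2 => ∅
  let φ : ℕ → E3 × E3 → Amb
    | 0 => chart 1
    | _ + 1 => chart (-1)
  have hdisj : Disjoint (φ 0 '' T 0) (φ 1 '' T 1) := by
    refine disjoint_left.2 ?_
    rintro _ ⟨t, -, rfl⟩ ⟨s, hs, hst⟩
    have h1 : 1 + (chart (-1) s).2.2.1 2 = 0 := hs.2
    have h2 : chart (-1) s = chart 1 t := hst
    have h3 := one_add_chart hp t
    rw [one_mul, ← h2, h1] at h3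
    exact div_ne_zero two_ne_zero (chartNorm_pos t).ne' h3.symm
  refine ⟨fun _ => halfSpace, T, φ, ?_, ?_, ?_, ?_, ?_⟩
  · rintro (_ | i)
    exacts [isOrientedParam_chart hp, isOrientedParam_chart hm]
  · rintro (_ | _ | i)
    exacts [inter_subset_left, inter_subset_left.trans inter_subset_left, empty_subset _]
  · rintro (_ | _ | i)
    exacts [(hclosed 1).measurableSet,
      ((hclosed (-1)).inter (hZ.preimage (contDiff_chart (-1)).continuous)).measurableSet,
      MeasurableSet.empty]
  · rintro (_ | _ | i) (_ | _ | j) hij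
    all_goals first
      | exact absurd rfl hij
      | exact hdisj
      | exact hdisj.symm
      | simp [T]
  · refine subset_antisymm (iUnion_subset ?_) fun q hq => ?_
    · rintro (_ | _ | i)
      · rintro _ ⟨t, ht, rfl⟩
        exact ht.2
      · rintro _ ⟨t, ht, rfl⟩
        exact ht.1.2
      · simp [T]
    · have hq' : q ∈ C2 univ := C2_mono (subset_univ Ω) hq
      by_cases h : 1 + q.2.2.1 2 = 0
      · have hne : 1 + (-1) * q.2.2.1 2 ≠ 0 := by
          rw [show q.2.2.1 2 = -1 by linarith]
          norm_num
        have hc := chart_chartInv hm hq' hne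
        refine mem_iUnion.2 ⟨1, chartInv (-1) q, ⟨⟨chartInv_mem_halfSpace hm hq', ?_⟩, ?_⟩, hc⟩
        · rwa [mem_preimage, hc]
        · rw [mem_preimage, hc]
          exact h
      · have hc := chart_chartInv hp hq' (by rwa [one_mul])
        refine mem_iUnion.2 ⟨0, chartInv 1 q, ⟨chartInv_mem_halfSpace hp hq', ?_⟩, hc⟩
        rwa [mem_preimage, hc]

end Helicity

/-- For a smooth 2-form `α` on a compact `Ω ⊂ ℝ³` and the vector field `V` dual to it, the form
`Φ = α_x ∧ α_y ∧ g^* dVol_{S²}` agrees with the classical helicity integrand on `C₂(Ω)`, the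
classical helicity integral converges absolutely, and it is the integral of `Φ` over `C₂[Ω]`. -/
theorem mainTheorem2 (Ω : Set Helicity.E3) (hΩ : IsCompact Ω)
    (α : Helicity.E3 → Helicity.E3 [⋀^Fin 2]→L[ℝ] ℝ) (hα : ContDiffOn ℝ ∞ α Ω)
    (V : Helicity.E3 → Helicity.E3)
    (hV : ∀ x ∈ Ω, ∀ W₁ W₂ : Helicity.E3, α x ![W₁, W₂] = Helicity.dVol ![V x, W₁, W₂]) :
    (∀ p ∈ Helicity.C2Open Ω,
      Helicity.coeff (Helicity.Phi α) (Helicity.C2Open Set.univ) Helicity.iota p =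
        1 / (4 * Real.pi) * Helicity.classicalIntegrand V p) ∧
    MeasureTheory.IntegrableOn (Helicity.classicalIntegrand V) (Ω ×ˢ Ω) ∧
    Helicity.HasFormIntegral (Helicity.Phi α) (Helicity.C2 Ω)
      (1 / (4 * Real.pi) * ∫ p in Ω ×ˢ Ω, Helicity.classicalIntegrand V p) := by
  have hint := Helicity.integrableOn_classicalIntegrand hΩ
    (Helicity.continuousOn_dual hα.continuousOn hV)
  refine ⟨fun p hp => Helicity.coeff_Phi_iota hV hp, hint,
    Helicity.exists_isCutting hΩ.isClosed, ?_⟩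
  intro D T φ h
  rw [← MeasureTheory.integral_const_mul]
  exact h.hasSum (fun p hp => Helicity.coeff_Phi_iota hV hp) (hint.const_mul _)
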